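/- **Setting.** Let $\mathcal H$ be a separable complex Hilbert space, $\mathcal E\subseteq B(\mathcal H)$ a unital $C^*$-algebra, and $(\mathcal E_{[s,t]})_{s\le t}$ unital $*$-subalgebras of $\mathcal E$ with $\mathcal E_{[s',t']}\subseteq\mathcal E_{[s,t]}$ whenever $[s',t']\subseteq[s,t]$. Let $\mathcal E_{\ge t}$ be the norm closure of the algebra generated by $\bigcup_{t'>t}\mathcal E_{[t,t']}$, let $\mathcal E^-$, $\mathcal E_{\ge t}^-$ be closures in the weak operator topology, and $\mathcal E_\infty=\bigcap_{t\in\mathbb R}\mathcal E_{\ge t}^-$. Let $\mathcal X$ be a finite set, and for $t\in\mathbb R$ let $(\Pi_\xi(t))_{\xi\in\mathcal X}$ be commuting orthogonal projections in $\mathcal E_{\ge t}$ with $\sum_{\xi}\Pi_\xi(t)=\mathbf 1$. Let $t_1<t_2<\cdots$ be times, and for a sequence $(\xi_k)$ in $\mathcal X$ put $\Pi_{\underline\xi^{(m,n)}}=\Pi_{\xi_m}(t_m)\cdots\Pi_{\xi_n}(t_n)$ ($=\mathbf 1$ for $m>n$). Assume * (ideal decoherence) $\sum_{\xi_i\in\mathcal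 X}\Pi_{\underline\xi^{(m,n)}}\Pi_{\underline\xi^{(m,n)}}^*=\Pi_{\underline\xi^{(m,i-1)}}\Pi_{\underline\xi^{(i+1,n)}}\big(\Pi_{\underline\xi^{(m,i-1)}}\Pi_{\underline\xi^{(i+1,n)}}\big)^*$ for all $m\le i\le n$; * (asymptotic abelianness) $\mathcal E_\infty$ is contained in the center of $\mathcal E^-$. Let $\Xi=\mathcal X^{\mathbb N}$ with the $\sigma$-algebra $\Sigma$ generated by cylinder sets, let $\Sigma_n$ be the $\sigma$-algebra generated by the sets $\mathcal X^n\times C$ with $C$ a cylinder set, and $\Sigma_\infty=\bigcap_n\Sigma_n$. Let $\omega$ be a normal state on $\mathcal E^-$ (given by a density matrix). There is exactly one probability measure $\mu_\omega$ on $(\Xi,\Sigma)$ that gives the event "the outcomes number $m,\dots,n$ are $\xi_m,\dots,\xi_n$" the probability $\omega\big(\Pi_{\underline\xi^{(m,n)}}\Pi_{\underline\xi^{(m,n)}}^*\big)$, for all $m,n$ and $\underline\xi$. A measure $\rho$ on $\Xi$ is *disintegrated* by a family $(\mu(\cdot|\underline\xi))_{\underline\xi\in\Xi}$ of probability measures if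 $\int_\Lambda\mu(\Delta|\underline\xi)\,d\rho(\underline\xi)=\rho(\Lambda\cap\Delta)$ for all $\Delta\in\Sigma$, $\Lambda\in\Sigma_\infty$. A *$\Sigma_\infty$-ergodic disintegration* of $\mu_\omega$ is such a family that disintegrates $\mu_\omega$, for which $\underline\xi\mapsto\mu(\Delta|\underline\xi)$ is $\Sigma_\infty$-measurable for each $\Delta\in\Sigma$, and such that for $\mu_\omega$-almost every $\underline\xi$ one has $\mu(\Lambda|\underline\xi)\in\{0,1\}$ for all $\Lambda\in\Sigma_\infty$. Given such a family, put $\mathrm{Mol}(\underline\xi)=\{\underline\xi':\mu(\cdot|\underline\xi')=\mu(\cdot|\underline\xi)\}$, let $\widetilde\Xi$ be the set of all $\underline\xi$ such that $\mu(\cdot|\underline\xi)$ is disintegrated by the family and $\mu(\mathrm{Mol}(\underline\xi)|\underline\xi)=1$, let $p:\widetilde\Xi\to\Xi^\infty$ be the quotient map that identifies the points of each molecule, let $\Sigma^\infty$ be the $\sigma$-algebra generated by the sets $E\subseteq\Xi^\infty$ with $p^{-1}(E)\in\Sigma_\infty$, and put $\mu(\cdot|\nu)=\mu(\cdot|\underline\xi)$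 for $\nu=p(\underline\xi)$. **Corollary 1.7.** The measure $\mu_\omega$ has a $\Sigma_\infty$-ergodic disintegration. For every such disintegration, let $\mathcal K$ be the set of all Radon probability measures on $\Xi$ that are disintegrated by $(\mu(\cdot|\underline\xi))_{\underline\xi\in\Xi}$. Then: 1. $\mathcal K$ is convex, and its extreme points are exactly the measures $\mu(\cdot|\nu)$, $\nu\in\Xi^\infty$. 2. $\widetilde\Xi\in\Sigma$, and $\rho(\widetilde\Xi)=1$ for every $\rho\in\mathcal K$. A Radon probability measure $\rho$ belongs to $\mathcal K$ if and only if it is disintegrated by $(\mu(\cdot|\nu))_{\nu\in\Xi^\infty}$, that is, $P(E)=\rho(p^{-1}(E))$ defines a probability measure on $(\Xi^\infty,\Sigma^\infty)$ and $\int_E\mu(\Delta|\nu)\,dP(\nu)=\rho(p^{-1}(E)\cap\Delta)$ for all $\Delta\in\Sigma$, $E\in\Sigma^\infty$. 3. (Choquet-type decomposition) $\mu_\omega\in\mathcal K$; for each $\Delta\in\Sigma$ the function $\nu\mapsto\mu(\Delta|\nu)$ is $\Sigma^\infty$-measurable; and for every $\rho\in\mathcal K$, $P(E)=\rho(p^{-1}(E))$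 defines a probability measure on $(\Xi^\infty,\Sigma^\infty)$ with $\rho=\int_{\Xi^\infty}\mu(\cdot|\nu)\,dP(\nu)$, and $P$ is the only probability measure with this property. In particular this holds for $\rho=\mu_\omega$. -/

import Mathlib

open MeasureTheory
open scoped ENNReal NNReal

noncomputable section

namespace Histories

/-! ### Operator algebras and the quantum-mechanical model -/

section Quantum

variable {H : Type*} [NormedAddCommGroup H] [InnerProductSpace ℂ H] [CompleteSpace H]

/-- The closure of a set of bounded operators in the weak operator topology. -/
def weakClosure (M : Set (H →L[ℂ] H)) : Set (H →L[ℂ] H) :=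
  {A | (ContinuousLinearMapWOT.ofCLM A : H →WOT[ℂ] H) ∈
    closure ((fun B : H →L[ℂ] H => (ContinuousLinearMapWOT.ofCLM B : H →WOT[ℂ] H)) '' M)}

/-- `ω` is a normal state on the set `M` of operators: `ω(A) = tr(P A)` for `A ∈ M`, with the
density matrix `P = ∑ₙ |ψₙ⟩⟨ψₙ|`, `tr P = ∑ₙ ‖ψₙ‖² = 1`. Values of `ω` outside `M` play no role. -/
def IsNormalState (M : Set (H →L[ℂ] H)) (ω : (H →L[ℂ] H) → ℂ) : Prop :=
  ∃ ψ : ℕ → H, HasSum (fun n => ‖ψ n‖ ^ 2) 1 ∧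
    ∀ A ∈ M, HasSum (fun n => inner ℂ (ψ n) (A (ψ n))) (ω A)

variable (H) in
/-- A physical system with a single instrument, with outcomes in the finite set `X`, that is
triggered at times `time 0 < time 1 < ⋯`. -/
structure QuantumSystem (X : Type*) [Fintype X] where
  /-- The C*-algebra `𝓔` generated by all observables. -/
  alg : StarSubalgebra ℂ (H →L[ℂ] H)
  isClosed_alg : IsClosed (alg : Set (H →L[ℂ] H))
  /-- The algebra `𝓔_[s,t]` of the quantities measurable in the time interval `[s,t]`. -/
  loc : ℝ → ℝ → StarSubalgebra ℂ (H →L[ℂ] H)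
  loc_mono : ∀ s s' t' t : ℝ, s ≤ s' → s' ≤ t' → t' ≤ t → loc s' t' ≤ loc s t
  loc_le : ∀ s t : ℝ, s ≤ t → loc s t ≤ alg
  /-- The projections `Π_ξ(t)` representing the instrument at time `t`. -/
  proj : X → ℝ → (H →L[ℂ] H)
  isStarProjection_proj : ∀ x t, IsStarProjection (proj x t)
  proj_mem : ∀ x t, proj x t ∈ (⨆ t' ∈ Set.Ioi t, loc t t').topologicalClosure
  commute_proj : ∀ x y t, Commute (proj x t) (proj y t)
  sum_proj : ∀ t, ∑ x, proj x t = 1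
  /-- The times at which the instrument is triggered. -/
  time : ℕ → ℝ
  strictMono_time : StrictMono time

namespace QuantumSystem

variable {X : Type*} [Fintype X] (S : QuantumSystem H X)

/-- `𝓔_{≥ t}`, a norm closure. -/
def algAfter (t : ℝ) : StarSubalgebra ℂ (H →L[ℂ] H) :=
  (⨆ t' ∈ Set.Ioi t, S.loc t t').topologicalClosure

/-- The von Neumann algebra `𝓔⁻`. -/
def vN : Set (H →L[ℂ] H) := weakClosure (S.alg : Set (H →L[ℂ] H))

/-- The algebra `𝓔_∞ = ⋂ₜ 𝓔_{≥ t}⁻` of asymptotic observables. -/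
def asymptoticAlg : Set (H →L[ℂ] H) :=
  ⋂ t : ℝ, weakClosure (S.algAfter t : Set (H →L[ℂ] H))

/-- The ordered product `Π_{ξ_m}(t_m) ⋯ Π_{ξ_{n-1}}(t_{n-1})`; it is `1` if `n ≤ m`. -/
def historyOp (ξ : ℕ → X) (m n : ℕ) : H →L[ℂ] H :=
  ((List.range' m (n - m)).map fun k => S.proj (ξ k) (S.time k)).prod

/-- Summation over the outcome of the `i`-th measurement removes that measurement. -/
def IdealDecoherence : Prop :=
  ∀ (m i n : ℕ), m ≤ i → i < n → ∀ ξ : ℕ → X,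
    ∑ x : X, S.historyOp (Function.update ξ i x) m n *
        star (S.historyOp (Function.update ξ i x) m n) =
      (S.historyOp ξ m i * S.historyOp ξ (i + 1) n) *
        star (S.historyOp ξ m i * S.historyOp ξ (i + 1) n)

/-- `𝓔_∞` is contained in the center of `𝓔⁻`. -/
def AsymptoticAbelianness : Prop :=
  ∀ A ∈ S.asymptoticAlg, A ∈ S.vN ∧ ∀ B ∈ S.vN, A * B = B * A

/-- `μ` is the law `μ_ω` of histories in the state `ω`: the probability of observing
`ξ_m, …, ξ_{n-1}` in the measurements `m, …, n-1` is `ω(Π Π*)`. -/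
structure IsHistoryMeasure [MeasurableSpace X] (ω : (H →L[ℂ] H) → ℂ)
    (μ : Measure (ℕ → X)) : Prop where
  isProbabilityMeasure : IsProbabilityMeasure μ
  cylinder : ∀ (ξ : ℕ → X) (m n : ℕ),
    ((μ.real {η | ∀ k, m ≤ k → k < n → η k = ξ k} : ℝ) : ℂ) =
      ω (S.historyOp ξ m n * star (S.historyOp ξ m n))

end QuantumSystem

end Quantum

/-! ### Disintegration with respect to the tail σ-algebra -/

section Tail

variable {X : Type*} [MeasurableSpace X]

variable (X) in
/-- The tail σ-algebra `Σ_∞ = ⋂ₙ Σₙ`, where `Σₙ` is generated by the sets `Xⁿ × C`. -/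
@[reducible] def tailAlgebra : MeasurableSpace (ℕ → X) :=
  ⨅ n : ℕ, MeasurableSpace.comap (fun (ξ : ℕ → X) (k : ℕ) => ξ (n + k)) MeasurableSpace.pi

/-- `ρ` is disintegrated with respect to `Σ_∞` by the family `(κ ξ)_ξ`. -/
def IsDisintegratedBy (ρ : Measure (ℕ → X)) (κ : (ℕ → X) → Measure (ℕ → X)) : Prop :=
  ∀ Δ Λ : Set (ℕ → X), MeasurableSet Δ → MeasurableSet[tailAlgebra X] Λ →
    ∫⁻ ξ in Λ, κ ξ Δ ∂ρ = ρ (Λ ∩ Δ)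

/-- `κ` is a `Σ_∞`-ergodic disintegration of `μ`. -/
structure IsErgodicDisintegration (μ : Measure (ℕ → X))
    (κ : (ℕ → X) → Measure (ℕ → X)) : Prop where
  isProbabilityMeasure : ∀ ξ, IsProbabilityMeasure (κ ξ)
  measurable : ∀ Δ : Set (ℕ → X), MeasurableSet Δ →
    Measurable[tailAlgebra X] fun ξ => κ ξ Δ
  isDisintegratedBy : IsDisintegratedBy μ κ
  ergodic : ∀ᵐ ξ ∂μ, ∀ Λ : Set (ℕ → X), MeasurableSet[tailAlgebra X] Λ → κ ξ Λ = 0 ∨ κ ξ Λ = 1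

/-- `Mol(ξ)`. -/
def molecule (κ : (ℕ → X) → Measure (ℕ → X)) (ξ : ℕ → X) : Set (ℕ → X) := {ξ' | κ ξ = κ ξ'}

/-- The set of `ξ` such that `κ ξ` is disintegrated by `κ` and carried by the molecule of `ξ`. -/
def regularSet (κ : (ℕ → X) → Measure (ℕ → X)) : Set (ℕ → X) :=
  {ξ | IsDisintegratedBy (κ ξ) κ ∧ κ ξ (molecule κ ξ) = 1}

/-- Two points are equivalent if they lie in the same molecule. -/
def moleculeSetoid (κ : (ℕ → X) → Measure (ℕ → X)) : Setoid (regularSet κ) :=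
  Setoid.ker fun ξ => κ ξ

/-- The set `Ξ^∞` of molecules. -/
def MoleculeSpace (κ : (ℕ → X) → Measure (ℕ → X)) : Type _ := Quotient (moleculeSetoid κ)

/-- The preimage of a set of molecules, as a set of histories. -/
def preimageMol (κ : (ℕ → X) → Measure (ℕ → X)) (E : Set (MoleculeSpace κ)) : Set (ℕ → X) :=
  Subtype.val '' {ξ : regularSet κ | (Quotient.mk (moleculeSetoid κ) ξ : MoleculeSpace κ) ∈ E}

/-- The σ-algebra `Σ^∞` generated by the sets of molecules with preimage in `Σ_∞`. -/
instance (κ : (ℕ → X) → Measure (ℕ → X)) : MeasurableSpace (MoleculeSpace κ) :=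
  MeasurableSpace.generateFrom {E | MeasurableSet[tailAlgebra X] (preimageMol κ E)}

/-- The measure `μ(· | ν)`, `ν ∈ Ξ^∞`. -/
def molMeasure (κ : (ℕ → X) → Measure (ℕ → X)) (ν : MoleculeSpace κ) : Measure (ℕ → X) :=
  Quotient.lift (s := moleculeSetoid κ) (fun ξ : regularSet κ => κ ξ) (fun _ _ h => h) ν

/-- The set `𝓚` of Radon probability measures on `Ξ` that are disintegrated by `κ`. -/
def disintegratedSet [TopologicalSpace X] (κ : (ℕ → X) → Measure (ℕ → X)) :
    Set (Measure (ℕ → X)) :=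
  {ρ | IsProbabilityMeasure ρ ∧ ρ.Regular ∧ IsDisintegratedBy ρ κ}

/-- `P` is the image on `Ξ^∞` of the measure `ρ`. -/
def IsImage (ρ : Measure (ℕ → X)) (κ : (ℕ → X) → Measure (ℕ → X))
    (P : Measure (MoleculeSpace κ)) : Prop :=
  ∀ E : Set (MoleculeSpace κ), MeasurableSet E → P E = ρ (preimageMol κ E)

/-- `ρ` is disintegrated with respect to `Σ^∞` by `(μ(· | ν))_ν`: its image `P` on `Ξ^∞` is a
probability measure, and `∫_E μ(Δ | ν) dP(ν) = ρ(p⁻¹(E) ∩ Δ)`. -/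
def IsMolDisintegrated (ρ : Measure (ℕ → X)) (κ : (ℕ → X) → Measure (ℕ → X)) : Prop :=
  ∃ P : Measure (MoleculeSpace κ), IsProbabilityMeasure P ∧ IsImage ρ κ P ∧
    ∀ (Δ : Set (ℕ → X)) (E : Set (MoleculeSpace κ)), MeasurableSet Δ → MeasurableSet E →
      ∫⁻ ν in E, molMeasure κ ν Δ ∂P = ρ (preimageMol κ E ∩ Δ)

/-- `ρ = ∫ μ(· | ν) dP(ν)`. -/
def IsMixture (ρ : Measure (ℕ → X)) (κ : (ℕ → X) → Measure (ℕ → X))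
    (P : Measure (MoleculeSpace κ)) : Prop :=
  ∀ Δ : Set (ℕ → X), MeasurableSet Δ → ρ Δ = ∫⁻ ν, molMeasure κ ν Δ ∂P

end Tail

end Histories

end

open Histories

/-! The laws of the initial segments of a history are consistent by ideal decoherence, so that they
have a limit `μ_ω` in the compact space of probability measures on `Ξ`.

A disintegration with respect to `Σ_∞` is almost everywhere unique, hence almost everywhere equal
to the conditional expectation kernel. As `Σ_∞` is not countably generated, it is not obvious that
almost every conditional measure satisfies the zero-one law on `Σ_∞`. The zero-one law is,
however, equivalent to `sup_{B ∈ Σₙ} |ν(A ∩ B) - ν(A) ν(B)| → 0` for all events `A`, which need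
only be tested on countably many `A` and `B`, and this mixing property holds for almost every
conditional measure by Lévy's downward theorem `𝔼[1_A | Σₙ] → 𝔼[1_A | Σ_∞]`. For the same reason
`Ξ̃`, the set of all `ξ` such that `κ ξ` is mixing and carried by the molecule of `ξ`, belongs to
`Σ_∞` and is conull for every measure in `𝓚`. Integrals over `Ξ̃` can therefore be taken over
molecules, and since `κ ξ` is carried by one molecule, a mixture of these measures determines the
mixing measure.

A measure in `𝓚` that gives some `Λ ∈ Σ_∞` a mass strictly between `0` and `1` is a proper mixture
of its conditionings on `Λ` and `Λᶜ`. An extreme point thus satisfies the zero-one law, so it is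
disintegrated by a constant kernel and coincides with some `κ ξ`. -/

namespace Histories

open Filter Topology ProbabilityTheory

/-! ### The law of histories -/

section Window

variable {X : Type*}

/-- The cylinder set of all histories that agree with `ξ` at the places `m, …, n - 1`. -/
def window (ξ : ℕ → X) (m n : ℕ) : Set (ℕ → X) := {η | ∀ k, m ≤ k → k < n → η k = ξ k}

theorem window_eq_iInter (ξ : ℕ → X) (m n : ℕ) :
    window ξ m n = ⋂ k ∈ Finset.Ico m n, (fun η => η k) ⁻¹' {ξ k} := by
  ext η
  simp [window]

theorem window_of_le (ξ : ℕ → X) {m n : ℕ} (h : n ≤ m) : window ξ m n = Set.univ := by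
  simp [window_eq_iInter, Finset.Ico_eq_empty_of_le h]

theorem window_update_first (ξ : ℕ → X) {m n : ℕ} (h : m < n) (x : X) :
    window (Function.update ξ m x) m n = window ξ (m + 1) n ∩ (fun η => η m) ⁻¹' {x} := by
  ext η
  constructor
  · intro hη
    refine ⟨fun k hm hn => ?_, by simpa using hη m le_rfl h⟩
    simpa [(Nat.lt_of_succ_le hm).ne'] using hη k (by omega) hn
  · rintro ⟨hη, rfl⟩ k hm hn
    rcases hm.eq_or_lt with rfl | hm
    · simp
    · simpa [hm.ne'] using hη k hm hn

theorem window_update_last (ξ : ℕ → X) {m n : ℕ} (h : m ≤ n) (x : X) :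
    window (Function.update ξ n x) m (n + 1) = window ξ m n ∩ (fun η => η n) ⁻¹' {x} := by
  ext η
  constructor
  · intro hη
    refine ⟨fun k hm hn => ?_, by simpa using hη n h n.lt_succ_self⟩
    simpa [hn.ne] using hη k hm (by omega)
  · rintro ⟨hη, rfl⟩ k hm hn
    rcases (Nat.le_of_lt_succ hn).eq_or_lt with rfl | hn
    · simp
    · simpa [hn.ne] using hη k hm hn

theorem isClopen_window [TopologicalSpace X] [DiscreteTopology X] (ξ : ℕ → X) (m n : ℕ) :
    IsClopen (window ξ m n) := by
  rw [window_eq_iInter]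
  exact isClopen_biInter_finset fun k _ => (isClopen_discrete _).preimage (continuous_apply k)

theorem measurableSet_window [MeasurableSpace X] [MeasurableSingletonClass X]
    (ξ : ℕ → X) (m n : ℕ) : MeasurableSet (window ξ m n) := by
  rw [window_eq_iInter]
  exact Finset.measurableSet_biInter _ fun k _ =>
    measurable_pi_apply k (measurableSet_singleton _)

theorem sum_measure_inter_eval_preimage [Fintype X] [MeasurableSpace X]
    [MeasurableSingletonClass X] (μ : Measure (ℕ → X)) (A : Set (ℕ → X)) (k : ℕ) :
    ∑ x, μ (A ∩ (fun η => η k) ⁻¹' {x}) = μ A := by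
  have hmeas (x : X) : MeasurableSet ((fun η : ℕ → X => η k) ⁻¹' {x}) :=
    measurable_pi_apply k (measurableSet_singleton x)
  simpa [Measure.restrict_apply (hmeas _), Set.inter_comm A] using
    sum_measure_preimage_singleton (μ := μ.restrict A) Finset.univ fun x _ => hmeas x

theorem ext_of_window [Countable X] [MeasurableSpace X] [MeasurableSingletonClass X]
    {μ ν : Measure (ℕ → X)} [IsFiniteMeasure μ]
    (h : ∀ ξ n, μ (window ξ 0 n) = ν (window ξ 0 n)) : μ = ν := by
  have hproj := isProjectiveMeasureFamily_map_restrict (P := μ)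
    fun k => (measurable_pi_apply (X := fun _ : ℕ => X) k).aemeasurable
  refine IsProjectiveLimit.unique (P := fun I => μ.map I.restrict) (fun I => rfl)
    ((isProjectiveLimit_nat_iff hproj ν).2 fun n => Measure.ext_of_singleton fun a => ?_)
  let ξ : ℕ → X := fun k => if hk : k ∈ Finset.Iic n then a ⟨k, hk⟩ else a ⟨0, by simp⟩
  have hfiber : Preorder.frestrictLe (π := fun _ : ℕ => X) n ⁻¹' {a} = window ξ 0 (n + 1) := by
    ext η
    simp +contextual [window, funext_iff, ξ]
  rw [Measure.map_apply (by fun_prop) (measurableSet_singleton a)]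
  change _ = μ.map (Preorder.frestrictLe n) {a}
  rw [Measure.map_apply (by fun_prop) (measurableSet_singleton a), hfiber, h]

variable [Fintype X] [Nonempty X] [MeasurableSpace X] [MeasurableSingletonClass X]
  {p : (ℕ → X) → ℕ → ℝ≥0}

theorem exists_measure_window_of_le (hcongr : ∀ ξ η n, (∀ k < n, ξ k = η k) → p ξ n = p η n)
    (hsum : ∀ ξ n, ∑ x, p (Function.update ξ n x) (n + 1) = p ξ n) (n : ℕ) :
    ∃ μ : Measure (ℕ → X), ∀ k ≤ n, ∀ ξ, μ (window ξ 0 k) = p ξ k := by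
  classical
  inhabit X
  let e : (Fin n → X) → ℕ → X := fun a k => if h : k < n then a ⟨k, h⟩ else default
  have mem_iff (ξ : ℕ → X) (a : Fin n → X) : e a ∈ window ξ 0 n ↔ a = fun k : Fin n => ξ k := by
    simp +contextual [window, e, funext_iff, Fin.forall_iff]
  refine ⟨∑ a, (p (e a) n : ℝ≥0∞) • Measure.dirac (e a), fun k hk => ?_⟩
  induction hk using Nat.decreasingInduction with
  | self =>
    intro ξ
    have hξ : p (e fun k : Fin n => ξ k) n = p ξ n := hcongr _ _ _ fun k hk => by simp [e, hk]
    simp [measurableSet_window, Set.indicator_apply, mem_iff, hξ]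
  | of_succ k _ ih =>
    intro ξ
    rw [← sum_measure_inter_eval_preimage _ _ k, ← hsum ξ k, ENNReal.ofNNReal_finsetSum]
    refine Finset.sum_congr rfl fun x _ => ?_
    rw [← window_update_last ξ k.zero_le, ih]

/-- The space of probability measures on the compact space `ℕ → X` is compact, so that the
measures with the right law up to time `n` have a cluster point as `n → ∞`. -/
theorem exists_measure_window (hcongr : ∀ ξ η n, (∀ k < n, ξ k = η k) → p ξ n = p η n)
    (hzero : ∀ ξ, p ξ 0 = 1) (hsum : ∀ ξ n, ∑ x, p (Function.update ξ n x) (n + 1) = p ξ n) :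
    ∃ μ : Measure (ℕ → X), IsProbabilityMeasure μ ∧ ∀ ξ n, μ (window ξ 0 n) = p ξ n := by
  let _ : TopologicalSpace X := ⊥
  have : DiscreteTopology X := ⟨rfl⟩
  choose ν hν using exists_measure_window_of_le hcongr hsum
  have hprob (n : ℕ) : IsProbabilityMeasure (ν n) := by
    refine ⟨?_⟩
    rw [← window_of_le (fun _ => Classical.arbitrary X) le_rfl, hν n 0 n.zero_le, hzero,
      ENNReal.coe_one]
  let N : ℕ → ProbabilityMeasure (ℕ → X) := fun n => ⟨ν n, hprob n⟩
  obtain ⟨μ, -, hμ⟩ := isCompact_univ.ultrafilter_le_nhds ((hyperfilter ℕ).map N) (by simp)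
  refine ⟨μ, inferInstance, fun ξ n => ?_⟩
  have hfrontier : (μ : Measure (ℕ → X)) (frontier (window ξ 0 n)) = 0 := by
    rw [(isClopen_window ξ 0 n).frontier_eq, measure_empty]
  have hlim := ProbabilityMeasure.tendsto_measure_of_null_frontier_of_tendsto'
    (L := (hyperfilter ℕ : Filter ℕ)) (μs := N) hμ hfrontier
  refine tendsto_nhds_unique hlim (tendsto_const_nhds.congr' ?_)
  filter_upwards [Nat.hyperfilter_le_atTop (eventually_ge_atTop n)] with k hk
  exact (hν k n hk ξ).symm

end Window

section Quantum

open scoped ComplexOrder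

variable {H : Type*} [NormedAddCommGroup H] [InnerProductSpace ℂ H]

namespace IsNormalState

variable {M : Set (H →L[ℂ] H)} {ω : (H →L[ℂ] H) → ℂ} (hω : IsNormalState M ω)
include hω

theorem map_sum {ι : Type*} {s : Finset ι} {A : ι → H →L[ℂ] H} (hA : ∀ i ∈ s, A i ∈ M)
    (hs : ∑ i ∈ s, A i ∈ M) : ω (∑ i ∈ s, A i) = ∑ i ∈ s, ω (A i) := by
  obtain ⟨ψ, -, h⟩ := hω
  refine (h _ hs).unique ?_
  simpa only [_root_.sum_apply, inner_sum] using hasSum_sum fun i hi => h (A i) (hA i hi)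

theorem map_one (h1 : 1 ∈ M) : ω 1 = 1 := by
  obtain ⟨ψ, hψ, h⟩ := hω
  refine (h 1 h1).unique ?_
  simpa [inner_self_eq_norm_sq_to_K] using Complex.hasSum_ofReal.2 hψ

theorem map_mul_star_nonneg [CompleteSpace H] {A : H →L[ℂ] H} (hA : A * star A ∈ M) :
    0 ≤ ω (A * star A) := by
  obtain ⟨ψ, -, h⟩ := hω
  refine (h _ hA).nonneg fun n => ?_
  rw [mul_apply_eq_comp, ContinuousLinearMap.star_eq_adjoint,
    ← ContinuousLinearMap.adjoint_inner_left, inner_self_eq_norm_sq_to_K]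
  positivity

theorem nontrivial : Nontrivial H := by
  obtain ⟨ψ, hψ, -⟩ := hω
  by_contra hH
  rw [not_nontrivial_iff_subsingleton] at hH
  exact one_ne_zero (hψ.unique (by simp [Subsingleton.elim (ψ _) 0, hasSum_zero]))

end IsNormalState

namespace QuantumSystem

variable [CompleteSpace H] {X : Type*} [Fintype X] (S : QuantumSystem H X)

theorem proj_mem_alg (x : X) (t : ℝ) : S.proj x t ∈ S.alg :=
  StarSubalgebra.topologicalClosure_minimal
    (iSup₂_le fun t' ht => S.loc_le t t' (Set.mem_Ioi.1 ht).le) S.isClosed_alg (S.proj_mem x t)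

theorem mem_vN_of_mem_alg {A : H →L[ℂ] H} (hA : A ∈ S.alg) : A ∈ S.vN :=
  subset_closure ⟨A, hA, rfl⟩

include S in
theorem nonempty_outcome [Nontrivial H] : Nonempty X := by
  by_contra hX
  rw [not_nonempty_iff] at hX
  simpa using S.sum_proj 0

theorem historyOp_mem_alg (ξ : ℕ → X) (m n : ℕ) : S.historyOp ξ m n ∈ S.alg := by
  refine list_prod_mem fun A hA => ?_
  obtain ⟨k, -, rfl⟩ := List.mem_map.1 hA
  exact S.proj_mem_alg _ _

theorem historyOp_mul_star_mem_alg (ξ : ℕ → X) (m n : ℕ) :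
    S.historyOp ξ m n * star (S.historyOp ξ m n) ∈ S.alg :=
  mul_mem (S.historyOp_mem_alg _ _ _) (star_mem (S.historyOp_mem_alg _ _ _))

theorem historyOp_of_le (ξ : ℕ → X) {m n : ℕ} (h : n ≤ m) : S.historyOp ξ m n = 1 := by
  simp [historyOp, Nat.sub_eq_zero_of_le h]

theorem historyOp_congr {ξ η : ℕ → X} {m n : ℕ} (h : ∀ k, m ≤ k → k < n → ξ k = η k) :
    S.historyOp ξ m n = S.historyOp η m n := by
  rw [historyOp, historyOp]
  congr 1
  refine List.map_congr_left fun k hk => ?_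
  rw [List.mem_range'_1] at hk
  rw [h k hk.1 (by omega)]

/-- The probability `ω(Π Π*)` of observing the outcomes `ξ_m, …, ξ_{n-1}` in the measurements
`m, …, n - 1`. Taking the real part loses nothing, since `ω(Π Π*) ≥ 0` for a normal state. -/
noncomputable def historyProb (ω : (H →L[ℂ] H) → ℂ) (ξ : ℕ → X) (m n : ℕ) : ℝ≥0 :=
  (ω (S.historyOp ξ m n * star (S.historyOp ξ m n))).re.toNNReal

variable {S} {ω : (H →L[ℂ] H) → ℂ}

theorem historyProb_congr {ξ η : ℕ → X} {m n : ℕ} (h : ∀ k, m ≤ k → k < n → ξ k = η k) :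
    S.historyProb ω ξ m n = S.historyProb ω η m n := by
  rw [historyProb, S.historyOp_congr h, historyProb]

variable (hω : IsNormalState S.vN ω)
include hω

theorem coe_historyProb (ξ : ℕ → X) (m n : ℕ) :
    ((S.historyProb ω ξ m n : ℝ) : ℂ) =
      ω (S.historyOp ξ m n * star (S.historyOp ξ m n)) := by
  have hnonneg := Complex.nonneg_iff.1 <|
    hω.map_mul_star_nonneg (S.mem_vN_of_mem_alg (S.historyOp_mul_star_mem_alg ξ m n))
  rw [historyProb, Real.coe_toNNReal _ hnonneg.1]
  exact Complex.ext rfl hnonneg.2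

theorem historyProb_of_le (ξ : ℕ → X) {m n : ℕ} (h : n ≤ m) : S.historyProb ω ξ m n = 1 := by
  simp [historyProb, S.historyOp_of_le ξ h,
    hω.map_one (S.mem_vN_of_mem_alg (one_mem S.alg))]

theorem sum_historyProb_update (hdec : S.IdealDecoherence) (ξ : ℕ → X) {m i n : ℕ} (hm : m ≤ i)
    (hn : i < n) :
    ((∑ x, S.historyProb ω (Function.update ξ i x) m n : ℝ≥0) : ℂ) =
      ω ((S.historyOp ξ m i * S.historyOp ξ (i + 1) n) *
        star (S.historyOp ξ m i * S.historyOp ξ (i + 1) n)) := by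
  rw [← hdec m i n hm hn ξ, hω.map_sum
    (fun x _ => S.mem_vN_of_mem_alg (S.historyOp_mul_star_mem_alg _ m n))
    (S.mem_vN_of_mem_alg (sum_mem fun x _ => S.historyOp_mul_star_mem_alg _ m n))]
  simp only [← coe_historyProb hω]
  push_cast
  rfl

theorem sum_historyProb_last (hdec : S.IdealDecoherence) (ξ : ℕ → X) {m n : ℕ} (h : m ≤ n) :
    ∑ x, S.historyProb ω (Function.update ξ n x) m (n + 1) = S.historyProb ω ξ m n := by
  have := sum_historyProb_update hω hdec ξ h n.lt_succ_self
  rw [S.historyOp_of_le ξ le_rfl, mul_one, ← coe_historyProb hω] at this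
  exact_mod_cast this

theorem sum_historyProb_first (hdec : S.IdealDecoherence) (ξ : ℕ → X) {m n : ℕ} (h : m < n) :
    ∑ x, S.historyProb ω (Function.update ξ m x) m n = S.historyProb ω ξ (m + 1) n := by
  have := sum_historyProb_update hω hdec ξ le_rfl h
  rw [S.historyOp_of_le ξ le_rfl, one_mul, ← coe_historyProb hω] at this
  exact_mod_cast this

variable [MeasurableSpace X]

theorem isHistoryMeasure_iff {μ : Measure (ℕ → X)} :
    S.IsHistoryMeasure ω μ ↔
      IsProbabilityMeasure μ ∧ ∀ ξ m n, μ (window ξ m n) = S.historyProb ω ξ m n := by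
  have hcyl (ξ : ℕ → X) (m n : ℕ) [IsFiniteMeasure μ] :
      μ (window ξ m n) = S.historyProb ω ξ m n ↔
        ((μ.real {η | ∀ k, m ≤ k → k < n → η k = ξ k} : ℝ) : ℂ) =
          ω (S.historyOp ξ m n * star (S.historyOp ξ m n)) := by
    rw [← coe_historyProb hω, Complex.ofReal_inj, measureReal_def, window,
      ← ENNReal.coe_toReal, ENNReal.toReal_eq_toReal_iff' (measure_ne_top μ _) ENNReal.coe_ne_top]
  exact ⟨fun h => have := h.1; ⟨h.1, fun ξ m n => (hcyl ξ m n).2 (h.2 ξ m n)⟩,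
    fun h => have := h.1; ⟨h.1, fun ξ m n => (hcyl ξ m n).1 (h.2 ξ m n)⟩⟩

/-- Ideal decoherence at the last measurement makes the laws of the initial segments consistent;
at the first measurement it yields the law of the outcomes `m, …, n - 1` from that of the outcomes
`0, …, n - 1`. -/
theorem existsUnique_isHistoryMeasure [MeasurableSingletonClass X] (hdec : S.IdealDecoherence) :
    ∃! μ : Measure (ℕ → X), S.IsHistoryMeasure ω μ := by
  have := hω.nontrivial
  have := S.nonempty_outcome
  simp only [isHistoryMeasure_iff hω]
  obtain ⟨μ, hμ, hinit⟩ := exists_measure_window (p := fun ξ n => S.historyProb ω ξ 0 n)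
    (fun ξ η n h => historyProb_congr fun k _ => h k) (fun ξ => historyProb_of_le hω ξ le_rfl)
    (fun ξ n => sum_historyProb_last hω hdec ξ n.zero_le)
  refine ⟨μ, ⟨hμ, fun ξ m n => ?_⟩, fun ν hν => ?_⟩
  · induction m generalizing ξ with
    | zero => exact hinit ξ n
    | succ m ih =>
      rcases lt_or_ge m n with h | h
      · rw [← sum_measure_inter_eval_preimage _ _ m, ← sum_historyProb_first hω hdec ξ h,
          ENNReal.ofNNReal_finsetSum]
        exact Finset.sum_congr rfl fun x _ => by rw [← window_update_first ξ h, ih]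
      · rw [window_of_le ξ (by omega), historyProb_of_le hω ξ (by omega), measure_univ,
          ENNReal.coe_one]
  · have := hν.1
    exact ext_of_window fun ξ n => by rw [hν.2, hinit]

end QuantumSystem

end Quantum

/-! ### Lévy's downward theorem -/

section DownwardMartingale

theorem starProjection_tendsto_iInf {𝕜 E ι : Type*} [RCLike 𝕜] [NormedAddCommGroup E]
    [InnerProductSpace 𝕜 E] [CompleteSpace E] [Preorder ι] {U : ι → Submodule 𝕜 E}
    [∀ i, (U i).HasOrthogonalProjection] [(⨅ i, U i).HasOrthogonalProjection] (hU : Antitone U)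
    (x : E) :
    Tendsto (fun i => (U i).starProjection x) atTop (𝓝 ((⨅ i, U i).starProjection x)) := by
  have hcl : (⨆ i, (U i)ᗮ).topologicalClosure = (⨅ i, U i)ᗮ := by
    rw [← Submodule.orthogonal_orthogonal_eq_closure, ← Submodule.iInf_orthogonal]
    simp
  have horth := Submodule.starProjection_tendsto_closure_iSup (fun i => (U i)ᗮ)
    (fun i j h => Submodule.orthogonal_le (hU h)) x
  simpa [hcl] using tendsto_const_nhds (x := x) |>.sub horth

variable {Ω : Type*} {mΩ : MeasurableSpace Ω} {μ : Measure Ω} {m : ℕ → MeasurableSpace Ω}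

theorem aestronglyMeasurable_iInf (hm : Antitone m) {f : Ω → ℝ}
    (hf : ∀ n, AEStronglyMeasurable[m n] f μ) : AEStronglyMeasurable[⨅ n, m n] f μ := by
  choose g hg hfg using hf
  have hmeas (n : ℕ) : Measurable[m n] fun ω => limsup (fun k => g k ω) atTop := by
    simp only [← limsup_nat_add (fun k => g k _) n]
    exact Measurable.limsup fun k => ((hg (k + n)).mono (hm (Nat.le_add_left n k))).measurable
  have hmeas_iInf : Measurable[⨅ n, m n] fun ω => limsup (fun k => g k ω) atTop := fun s hs =>
    MeasurableSpace.measurableSet_iInf.2 fun n => hmeas n hs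
  refine ⟨_, hmeas_iInf.stronglyMeasurable, ?_⟩
  filter_upwards [ae_all_iff.2 hfg] with ω hω
  simp only [← hω, limsup_const]

theorem lpMeas_iInf (hm : Antitone m) (p : ℝ≥0∞) :
    lpMeas ℝ ℝ (⨅ n, m n) p μ = ⨅ n, lpMeas ℝ ℝ (m n) p μ := by
  ext f
  simp only [Submodule.mem_iInf, mem_lpMeas_iff_aestronglyMeasurable]
  exact ⟨fun h n => h.mono (iInf_le m n), aestronglyMeasurable_iInf hm⟩

/-- Lévy's downward theorem in `L²`, where conditional expectations are orthogonal projections. -/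
theorem tendsto_eLpNorm_two_condExp_iInf [IsFiniteMeasure μ] (hm : Antitone m)
    (hle : ∀ n, m n ≤ mΩ) {f : Ω → ℝ} (hf : MemLp f 2 μ) :
    Tendsto (fun n => eLpNorm (μ[f | m n] - μ[f | ⨅ n, m n]) 2 μ) atTop (𝓝 0) := by
  have hle_iInf : ⨅ n, m n ≤ mΩ := (iInf_le m 0).trans (hle 0)
  have (n : ℕ) : Fact (m n ≤ mΩ) := ⟨hle n⟩
  have : Fact (⨅ n, m n ≤ mΩ) := ⟨hle_iInf⟩
  have hanti : Antitone fun n => lpMeas ℝ ℝ (m n) 2 μ := fun i j h g hg => by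
    rw [mem_lpMeas_iff_aestronglyMeasurable] at hg ⊢
    exact hg.mono (hm h)
  have : (⨅ n, lpMeas ℝ ℝ (m n) 2 μ).HasOrthogonalProjection := by
    rw [← lpMeas_iInf hm]
    infer_instance
  have hproj := starProjection_tendsto_iInf hanti hf.toLp
  simp only [← lpMeas_iInf hm] at hproj
  rw [Lp.tendsto_Lp_iff_tendsto_eLpNorm'] at hproj
  refine hproj.congr fun n => eLpNorm_congr_ae ?_
  exact (hf.condExpL2_ae_eq_condExp (𝕜 := ℝ) (hle n)).sub
    (hf.condExpL2_ae_eq_condExp (𝕜 := ℝ) hle_iInf)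

end DownwardMartingale

/-! ### Disintegrations -/

section Algebra

variable {Ω : Type*} {m : MeasurableSpace Ω}

theorem measurableSet_of_mem_of_eq_generateFrom {𝒜 : Set (Set Ω)}
    (hgen : m = MeasurableSpace.generateFrom 𝒜) {A : Set Ω} (hA : A ∈ 𝒜) : MeasurableSet A :=
  hgen ▸ MeasurableSpace.measurableSet_generateFrom hA

variable (m) in
theorem exists_countable_isSetAlgebra [hm : MeasurableSpace.CountablyGenerated Ω] :
    ∃ 𝒜 : Set (Set Ω), 𝒜.Countable ∧ IsSetAlgebra 𝒜 ∧ m = MeasurableSpace.generateFrom 𝒜 :=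
  ⟨generateSetAlgebra (MeasurableSpace.countableGeneratingSet Ω),
    countable_generateSetAlgebra (MeasurableSpace.countable_countableGeneratingSet),
    isSetAlgebra_generateSetAlgebra, by
      rw [generateFrom_generateSetAlgebra_eq, MeasurableSpace.generateFrom_countableGeneratingSet]⟩

theorem measurableSet_setOf_eq {α : Type*} {mα : MeasurableSpace α}
    [MeasurableSpace.CountablyGenerated Ω] (κ η : Kernel α Ω) [IsFiniteKernel κ]
    [IsFiniteKernel η] : MeasurableSet {a | κ a = η a} := by
  obtain ⟨𝒜, hcount, h𝒜, hgen⟩ := exists_countable_isSetAlgebra m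
  have hmeas A (hA : A ∈ 𝒜) : MeasurableSet A := measurableSet_of_mem_of_eq_generateFrom hgen hA
  have : {a | κ a = η a} = ⋂ A ∈ 𝒜, {a | κ a A = η a A} := by
    ext a
    simp only [Set.mem_ofPred_eq, Set.mem_iInter]
    exact ⟨fun h A _ => by rw [h], fun h => ext_of_generate_finite 𝒜 hgen
      h𝒜.isSetRing.isSetSemiring.isPiSystem h (h _ h𝒜.univ_mem)⟩
  rw [this]
  exact .biInter hcount fun A hA =>
    measurableSet_eq_fun (κ.measurable_coe (hmeas A hA)) (η.measurable_coe (hmeas A hA))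

theorem exists_mem_measureReal_symmDiff_lt {mΩ : MeasurableSpace Ω} (hm : m ≤ mΩ) (ν : Measure Ω)
    [IsFiniteMeasure ν] {𝒜 : Set (Set Ω)} (h𝒜 : IsSetAlgebra 𝒜)
    (hgen : m = MeasurableSpace.generateFrom 𝒜) {A : Set Ω} (hA : MeasurableSet[m] A) {ε : ℝ}
    (hε : 0 < ε) : ∃ B ∈ 𝒜, ν.real (symmDiff A B) < ε := by
  have hdense := @Measure.MeasureDense.of_generateFrom_isSetAlgebra_finite Ω m (ν.trim hm) 𝒜 _
    h𝒜 hgen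
  obtain ⟨B, hB, hlt⟩ := @Measure.MeasureDense.approx Ω m _ _ hdense A hA (measure_ne_top _ _) ε hε
  rw [trim_measurableSet_eq _ (hA.symmDiff (measurableSet_of_mem_of_eq_generateFrom hgen hB))]
    at hlt
  exact ⟨B, hB, by rwa [measureReal_def, ← ENNReal.lt_ofReal_iff_toReal_lt (measure_ne_top _ _)]⟩

end Algebra

section Disintegration

variable {Ω : Type*} {M mΩ : MeasurableSpace Ω} {ρ : Measure Ω}

/-- The kernel `κ` is a disintegration of `ρ` with respect to the sub-σ-algebra `M`. For
`M = Σ_∞` this is `IsDisintegratedBy`. -/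
def Disintegrates (κ : Kernel[M, mΩ] Ω Ω) (ρ : Measure Ω) : Prop :=
  ∀ Δ Λ : Set Ω, MeasurableSet Δ → MeasurableSet[M] Λ → ∫⁻ ω in Λ, κ ω Δ ∂ρ = ρ (Λ ∩ Δ)

theorem measurable_diag_of_le (hM : M ≤ mΩ) :
    Measurable[mΩ, M.prod mΩ] (Function.diag : Ω → Ω × Ω) :=
  (measurable_id'' hM).prodMk measurable_id

theorem measurableSet_setOf_apply_eq_apply [MeasurableSpace.CountablyGenerated Ω] (hM : M ≤ mΩ)
    (κ : Kernel[M, mΩ] Ω Ω) [IsFiniteKernel κ] :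
    MeasurableSet[M.prod mΩ] {x : Ω × Ω | κ x.1 = κ x.2} :=
  measurableSet_setOf_eq (mα := M.prod mΩ) (κ.comap Prod.fst measurable_fst)
    (κ.comap Prod.snd ((measurable_id'' hM).comp measurable_snd))

theorem disintegrates_iff_compProd_trim {κ : Kernel[M, mΩ] Ω Ω} [IsFiniteKernel κ]
    [IsFiniteMeasure ρ] (hM : M ≤ mΩ) : Disintegrates κ ρ ↔
      ρ.trim hM ⊗ₘ κ = @Measure.map Ω (Ω × Ω) mΩ (M.prod mΩ) Function.diag ρ := by
  have hl {Δ Λ : Set Ω} (hΔ : MeasurableSet Δ) (hΛ : MeasurableSet[M] Λ) :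
      (ρ.trim hM ⊗ₘ κ) (Λ ×ˢ Δ) = ∫⁻ ω in Λ, κ ω Δ ∂ρ := by
    rw [Measure.compProd_apply_prod hΛ hΔ, restrict_trim hM _ hΛ,
      lintegral_trim _ (κ.measurable_coe hΔ)]
  have hr {Δ Λ : Set Ω} (hΔ : MeasurableSet Δ) (hΛ : MeasurableSet[M] Λ) :
      @Measure.map Ω (Ω × Ω) mΩ (M.prod mΩ) Function.diag ρ (Λ ×ˢ Δ) = ρ (Λ ∩ Δ) :=
    @Measure.map_apply _ _ mΩ (M.prod mΩ) ρ _ (measurable_diag_of_le hM) _ (hΛ.prod hΔ)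
  refine ⟨fun h => Measure.ext_prod fun hΛ hΔ => ?_, fun h Δ Λ hΔ hΛ => ?_⟩
  · rw [hl hΔ hΛ, hr hΔ hΛ, h _ _ hΔ hΛ]
  · rw [← hl hΔ hΛ, h, hr hΔ hΛ]

theorem disintegrates_condExpKernel [StandardBorelSpace Ω] [IsFiniteMeasure ρ] (hM : M ≤ mΩ) :
    Disintegrates (condExpKernel ρ M) ρ :=
  (disintegrates_iff_compProd_trim hM).2 (compProd_trim_condExpKernel hM)

namespace Disintegrates

variable {κ κ' : Kernel[M, mΩ] Ω Ω}

theorem bind_eq (h : Disintegrates κ ρ) (hM : M ≤ mΩ) : ρ.bind κ = ρ := by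
  ext Δ hΔ
  rw [Measure.bind_apply hΔ (κ.measurable.mono hM le_rfl).aemeasurable, ← setLIntegral_univ,
    h Δ Set.univ hΔ .univ, Set.univ_inter]

variable [IsFiniteKernel κ] [IsFiniteMeasure ρ]

theorem ae_eq [IsFiniteKernel κ'] [MeasurableSpace.CountablyGenerated Ω] (h : Disintegrates κ ρ)
    (h' : Disintegrates κ' ρ) (hM : M ≤ mΩ) : κ =ᵐ[ρ] κ' :=
  ae_eq_of_ae_eq_trim (hm := hM) <| Kernel.ae_eq_of_compProd_eq <|
    ((disintegrates_iff_compProd_trim hM).1 h).trans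
      ((disintegrates_iff_compProd_trim hM).1 h').symm

theorem ae_ae_of_ae {p : Ω → Ω → Prop} (h : Disintegrates κ ρ) (hM : M ≤ mΩ)
    (hp : MeasurableSet[M.prod mΩ] {x : Ω × Ω | p x.1 x.2}) (hpρ : ∀ᵐ ω ∂ρ, p ω ω) :
    ∀ᵐ ω ∂ρ, ∀ᵐ ω' ∂κ ω, p ω ω' := by
  refine ae_of_ae_trim hM (Measure.ae_ae_of_ae_compProd (p := fun x => p x.1 x.2) ?_)
  rw [(disintegrates_iff_compProd_trim hM).1 h]
  exact (@ae_map_iff Ω (Ω × Ω) mΩ (M.prod mΩ) ρ _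
    (@Measurable.aemeasurable Ω (Ω × Ω) mΩ (M.prod mΩ) _ ρ (measurable_diag_of_le hM)) _ hp).2 hpρ

theorem ae_ae_eq [MeasurableSpace.CountablyGenerated Ω] (h : Disintegrates κ ρ) (hM : M ≤ mΩ) :
    ∀ᵐ ω ∂ρ, ∀ᵐ ω' ∂κ ω, κ ω = κ ω' :=
  h.ae_ae_of_ae hM (measurableSet_setOf_apply_eq_apply hM κ) (ae_of_all _ fun _ => rfl)

end Disintegrates

end Disintegration

/-! ### Mixing and the zero-one law -/

section Mixing

variable {Ω : Type*} {mΩ : MeasurableSpace Ω} {m : ℕ → MeasurableSpace Ω} {ν : Measure Ω}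

/-- The covariance of the indicator functions of `A` and `B`. -/
noncomputable def eventCov (ν : Measure Ω) (A B : Set Ω) : ℝ :=
  ν.real (A ∩ B) - ν.real A * ν.real B

theorem eventCov_comm (ν : Measure Ω) (A B : Set Ω) : eventCov ν A B = eventCov ν B A := by
  rw [eventCov, eventCov, Set.inter_comm, mul_comm]

theorem abs_eventCov_sub_le [IsProbabilityMeasure ν] {A B C : Set Ω} (hA : MeasurableSet A)
    (hB : MeasurableSet B) (hC : MeasurableSet C) :
    |eventCov ν A B - eventCov ν A C| ≤ 2 * ν.real (symmDiff B C) := by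
  have hinter : |ν.real (A ∩ B) - ν.real (A ∩ C)| ≤ ν.real (symmDiff B C) :=
    (abs_measureReal_sub_le_measureReal_symmDiff (hA.inter hB).nullMeasurableSet
      (hA.inter hC).nullMeasurableSet).trans <| measureReal_mono <| by
        rw [← Set.inter_symmDiff_distrib_left]
        exact Set.inter_subset_right
  have hmul : |ν.real A * (ν.real B - ν.real C)| ≤ ν.real (symmDiff B C) := by
    rw [abs_mul, abs_of_nonneg measureReal_nonneg]
    exact (mul_le_of_le_one_left (abs_nonneg _) measureReal_le_one).trans
      (abs_measureReal_sub_le_measureReal_symmDiff hB.nullMeasurableSet hC.nullMeasurableSet)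
  have hsplit : eventCov ν A B - eventCov ν A C =
      ν.real (A ∩ B) - ν.real (A ∩ C) - ν.real A * (ν.real B - ν.real C) := by
    rw [eventCov, eventCov]
    ring
  rw [hsplit, two_mul]
  exact (abs_sub _ _).trans (add_le_add hinter hmul)

theorem measurable_eventCov {α : Type*} {_ : MeasurableSpace α} (κ : Kernel α Ω) {A B : Set Ω}
    (hA : MeasurableSet A) (hB : MeasurableSet B) : Measurable fun a => eventCov (κ a) A B :=
  (κ.measurable_coe (hA.inter hB)).ennreal_toReal.sub
    ((κ.measurable_coe hA).ennreal_toReal.mul (κ.measurable_coe hB).ennreal_toReal)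

theorem abs_eventCov_le_of_generateFrom {m' mΩ : MeasurableSpace Ω} (hle : m' ≤ mΩ)
    {ν : Measure Ω} [IsProbabilityMeasure ν] {ℬ : Set (Set Ω)} (hℬ : IsSetAlgebra ℬ)
    (hgen : m' = MeasurableSpace.generateFrom ℬ) {A B : Set Ω} (hA : MeasurableSet A)
    (hB : MeasurableSet[m'] B) {c : ℝ} (h : ∀ B ∈ ℬ, |eventCov ν A B| ≤ c) :
    |eventCov ν A B| ≤ c := by
  refine le_of_forall_pos_le_add fun ε hε => ?_
  obtain ⟨C, hC, hlt⟩ := exists_mem_measureReal_symmDiff_lt hle ν hℬ hgen hB (half_pos hε)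
  have hBC := abs_eventCov_sub_le (ν := ν) hA (hle _ hB)
    (hle _ (measurableSet_of_mem_of_eq_generateFrom hgen hC))
  linarith [h C hC, abs_sub_abs_le_abs_sub (eventCov ν A B) (eventCov ν A C)]

variable (m ν) in
/-- `ν` is mixing (regular, in the terminology of Kolmogorov) along the decreasing σ-algebras
`m n`: each event is asymptotically independent of `m n`, uniformly over `m n`. -/
def IsMixing : Prop :=
  ∀ A, MeasurableSet A → ∀ ε > 0, ∃ n, ∀ B, MeasurableSet[m n] B → |eventCov ν A B| ≤ ε

/-- Zero-one law: `M` consists of events of `ν`-probability zero or one. -/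
def IsTrivialOn (M : MeasurableSpace Ω) {_ : MeasurableSpace Ω} (ν : Measure Ω) : Prop :=
  ∀ Λ, MeasurableSet[M] Λ → ν Λ = 0 ∨ ν Λ = 1

theorem IsMixing.isTrivialOn_iInf [IsFiniteMeasure ν] (h : IsMixing m ν) (hle : ∀ n, m n ≤ mΩ) :
    IsTrivialOn (⨅ n, m n) ν := by
  intro Λ hΛ
  have hΛn n : MeasurableSet[m n] Λ := iInf_le m n _ hΛ
  have hcov : eventCov ν Λ Λ = 0 := by
    refine abs_nonpos_iff.1 (le_of_forall_pos_le_add fun ε hε => ?_)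
    obtain ⟨n, hn⟩ := h Λ (hle 0 _ (hΛn 0)) ε hε
    simpa using hn Λ (hΛn n)
  have hidem : IsIdempotentElem (ν.real Λ) := by
    rw [eventCov, Set.inter_self, sub_eq_zero] at hcov
    exact hcov.symm
  refine (IsIdempotentElem.iff_eq_zero_or_one.1 hidem).imp
    (measureReal_eq_zero_iff (by finiteness)).1 fun h1 => ?_
  rw [← ofReal_measureReal, h1, ENNReal.ofReal_one]

theorem isMixing_iff_of_generateFrom {m : ℕ → MeasurableSpace Ω} {mΩ : MeasurableSpace Ω}
    {ν : Measure Ω} [IsProbabilityMeasure ν] (hle : ∀ n, m n ≤ mΩ)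
    {𝒜 : Set (Set Ω)} (h𝒜 : IsSetAlgebra 𝒜) (hgen : mΩ = MeasurableSpace.generateFrom 𝒜)
    {ℬ : ℕ → Set (Set Ω)} (hℬ : ∀ n, IsSetAlgebra (ℬ n))
    (hgen' : ∀ n, m n = MeasurableSpace.generateFrom (ℬ n)) :
    IsMixing m ν ↔
      ∀ A ∈ 𝒜, ∀ k : ℕ, ∃ n, ∀ B ∈ ℬ n, |eventCov ν A B| ≤ 1 / (k + 1) := by
  have h𝒜m A (hA : A ∈ 𝒜) : MeasurableSet A := measurableSet_of_mem_of_eq_generateFrom hgen hA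
  refine ⟨fun h A hA k => ?_, fun h A hA ε hε => ?_⟩
  · obtain ⟨n, hn⟩ := h A (h𝒜m A hA) (1 / (k + 1)) (by positivity)
    exact ⟨n, fun B hB => hn B (measurableSet_of_mem_of_eq_generateFrom (hgen' n) hB)⟩
  · obtain ⟨A', hA', hlt⟩ :=
      exists_mem_measureReal_symmDiff_lt le_rfl ν h𝒜 hgen hA (show 0 < ε / 4 by positivity)
    obtain ⟨k, hk⟩ := exists_nat_one_div_lt (half_pos hε)
    obtain ⟨n, hn⟩ := h A' hA' k
    refine ⟨n, fun B hB => ?_⟩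
    have hB' := abs_eventCov_le_of_generateFrom (hle n) (hℬ n) (hgen' n)
      (h𝒜m A' hA') hB hn
    have hAA' := abs_eventCov_sub_le (ν := ν) (hle n _ hB) hA (h𝒜m A' hA')
    rw [eventCov_comm] at hB' ⊢
    linarith [abs_sub_abs_le_abs_sub (eventCov ν B A) (eventCov ν B A')]

variable [hΩ : MeasurableSpace.CountablyGenerated Ω]

variable (m) in
theorem exists_countable_isMixing_iff (hle : ∀ n, m n ≤ mΩ)
    (hm : ∀ n, @MeasurableSpace.CountablyGenerated Ω (m n)) :
    ∃ (𝒜 : Set (Set Ω)) (ℬ : ℕ → Set (Set Ω)), 𝒜.Countable ∧ (∀ n, (ℬ n).Countable) ∧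
      (∀ A ∈ 𝒜, MeasurableSet A) ∧ (∀ n, ∀ B ∈ ℬ n, MeasurableSet[m n] B) ∧
      ∀ (ν : Measure Ω) [IsProbabilityMeasure ν], IsMixing m ν ↔
        ∀ A ∈ 𝒜, ∀ k : ℕ, ∃ n, ∀ B ∈ ℬ n, |eventCov ν A B| ≤ 1 / (k + 1) := by
  obtain ⟨𝒜, h𝒜c, h𝒜, hgen⟩ := exists_countable_isSetAlgebra mΩ
  choose ℬ hℬc hℬ hgen' using fun n => exists_countable_isSetAlgebra (m n) (hm := hm n)
  exact ⟨𝒜, ℬ, h𝒜c, hℬc, fun A hA => measurableSet_of_mem_of_eq_generateFrom hgen hA,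
    fun n B hB => measurableSet_of_mem_of_eq_generateFrom (hgen' n) hB,
    fun ν _ => isMixing_iff_of_generateFrom hle h𝒜 hgen hℬ hgen'⟩

theorem measurableSet_setOf_isMixing {α : Type*} {mα : MeasurableSpace α} (hle : ∀ n, m n ≤ mΩ)
    (hm : ∀ n, @MeasurableSpace.CountablyGenerated Ω (m n)) (κ : Kernel α Ω) [IsMarkovKernel κ] :
    MeasurableSet {a | IsMixing m (κ a)} := by
  obtain ⟨𝒜, ℬ, h𝒜c, hℬc, h𝒜m, hℬm, hiff⟩ := exists_countable_isMixing_iff m hle hm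
  simp only [hiff, Set.ofPred_forall, Set.ofPred_exists]
  exact .biInter h𝒜c fun A hA => .iInter fun k => .iUnion fun n => .biInter (hℬc n) fun B hB =>
    measurableSet_le (measurable_eventCov κ (h𝒜m A hA) (hle n _ (hℬm n B hB))).abs measurable_const

end Mixing

section ErgodicDecomposition

variable {Ω : Type*} {M m' mΩ : MeasurableSpace Ω} {m : ℕ → MeasurableSpace Ω} {ρ : Measure Ω}

theorem ae_forall_exists_lt_of_tendsto_lintegral {f : ℕ → Ω → ℝ≥0∞} (hf : ∀ n, Measurable (f n))
    (h : Tendsto (fun n => ∫⁻ ω, f n ω ∂ρ) atTop (𝓝 0)) :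
    ∀ᵐ ω ∂ρ, ∀ ε > 0, ∃ n, f n ω < ε := by
  have hliminf : ∀ᵐ ω ∂ρ, liminf (fun n => f n ω) atTop = 0 := by
    have hfatou := lintegral_liminf_le (u := atTop) (μ := ρ) hf
    rwa [h.liminf_eq, nonpos_iff_eq_zero, lintegral_eq_zero_iff (.liminf hf)] at hfatou
  filter_upwards [hliminf] with ω hω ε hε
  exact (frequently_lt_of_liminf_lt (by isBoundedDefault) (hω.trans_lt hε)).exists

theorem IsTrivialOn.disintegrates_const [IsProbabilityMeasure ρ] (h : IsTrivialOn M ρ)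
    (hM : M ≤ mΩ) : Disintegrates (@Kernel.const Ω Ω M mΩ ρ) ρ := by
  intro Δ Λ _ hΛ
  change ∫⁻ _ in Λ, ρ Δ ∂ρ = ρ (Λ ∩ Δ)
  rw [setLIntegral_const]
  rcases h Λ hΛ with h0 | h1
  · rw [h0, mul_zero, measure_mono_null Set.inter_subset_left h0]
  · rw [h1, mul_one, Set.inter_comm, measure_inter_conull ((prob_compl_eq_zero_iff (hM _ hΛ)).2 h1)]

variable [StandardBorelSpace Ω] [IsProbabilityMeasure ρ]

theorem ae_condExpKernel_real_inter (hM : M ≤ m') (hm' : m' ≤ mΩ) {A B : Set Ω}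
    (hA : MeasurableSet A) (hB : MeasurableSet[m'] B) :
    ∀ᵐ ω ∂ρ, (condExpKernel ρ M ω).real (A ∩ B) =
      ∫ η in B, (ρ⟦A|m'⟧) η ∂condExpKernel ρ M ω := by
  have hpull : ρ⟦A ∩ B|m'⟧ =ᵐ[ρ] B.indicator (ρ⟦A|m'⟧) := by
    rw [Set.inter_comm, ← Set.indicator_indicator]
    exact condExp_indicator ((integrable_const _).indicator hA) hB
  have hint : Integrable (B.indicator (ρ⟦A|m'⟧)) ρ := integrable_condExp.indicator (hm' _ hB)
  filter_upwards [condExpKernel_ae_eq_condExp (μ := ρ) (hM.trans hm') (hA.inter (hm' _ hB)),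
    condExp_condExp_of_le (μ := ρ) (f := (A ∩ B).indicator fun _ => (1 : ℝ)) hM hm',
    condExp_congr_ae (m := M) hpull,
    condExp_ae_eq_integral_condExpKernel (hM.trans hm') hint] with ω hker htower hcongr hintegral
  rw [hker, ← htower, hcongr, hintegral, integral_indicator (hm' _ hB)]

theorem ae_ae_condExp_eq_condExpKernel_real (hM : M ≤ mΩ) {A : Set Ω} (hA : MeasurableSet A) :
    ∀ᵐ ω ∂ρ, ∀ᵐ η ∂condExpKernel ρ M ω, (ρ⟦A|M⟧) η = (condExpKernel ρ M ω).real A := by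
  refine (disintegrates_condExpKernel hM).ae_ae_of_ae hM ?_
    ((condExpKernel_ae_eq_condExp hM hA).mono fun ω h => h.symm)
  exact measurableSet_eq_fun (m := M.prod mΩ)
    ((stronglyMeasurable_condExp.mono hM).measurable.comp measurable_snd)
    ((measurable_condExpKernel hA).ennreal_toReal.comp measurable_fst)

theorem ae_abs_eventCov_condExpKernel_le (hM : M ≤ m') (hm' : m' ≤ mΩ) {A B : Set Ω}
    (hA : MeasurableSet A) (hB : MeasurableSet[m'] B) :
    ∀ᵐ ω ∂ρ, ‖eventCov (condExpKernel ρ M ω) A B‖ₑ ≤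
      ∫⁻ η, ‖(ρ⟦A|m'⟧ - ρ⟦A|M⟧) η‖ₑ ∂condExpKernel ρ M ω := by
  filter_upwards [ae_condExpKernel_real_inter hM hm' hA hB,
    ae_ae_condExp_eq_condExpKernel_real (ρ := ρ) (hM.trans hm') hA,
    (integrable_condExp (m := m') (f := A.indicator fun _ => (1 : ℝ))).condExpKernel_ae (m := M),
    (integrable_condExp (m := M) (f := A.indicator fun _ => (1 : ℝ))).condExpKernel_ae (m := M)]
    with ω hinter hconst hint' hint
  have hcov : eventCov (condExpKernel ρ M ω) A B =
      ∫ η in B, (ρ⟦A|m'⟧ - ρ⟦A|M⟧) η ∂condExpKernel ρ M ω := by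
    simp only [Pi.sub_apply]
    rw [integral_sub hint'.integrableOn hint.integrableOn, ← hinter,
      integral_congr_ae (ae_restrict_of_ae hconst), setIntegral_const, smul_eq_mul, mul_comm,
      eventCov]
  rw [hcov]
  exact (enorm_integral_le_lintegral_enorm _).trans (setLIntegral_le_lintegral _ _)

theorem measurable_lintegral_condExp_sub (hM : M ≤ mΩ) (hm' : m' ≤ mΩ) (A : Set Ω) :
    Measurable fun ω => ∫⁻ η, ‖(ρ⟦A|m'⟧ - ρ⟦A|M⟧) η‖ₑ ∂condExpKernel ρ M ω := by
  refine (Measurable.lintegral_kernel ?_).mono hM le_rfl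
  exact ((stronglyMeasurable_condExp.mono hm').sub
    (stronglyMeasurable_condExp.mono hM)).measurable.enorm

theorem tendsto_lintegral_lintegral_condExp_sub (hm : Antitone m) (hle : ∀ n, m n ≤ mΩ)
    {A : Set Ω} (hA : MeasurableSet A) :
    Tendsto (fun n => ∫⁻ ω, ∫⁻ η, ‖(ρ⟦A|m n⟧ - ρ⟦A|⨅ n, m n⟧) η‖ₑ
      ∂condExpKernel ρ (⨅ n, m n) ω ∂ρ) atTop (𝓝 0) := by
  have hM : ⨅ n, m n ≤ mΩ := (iInf_le m 0).trans (hle 0)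
  have hL2 : MemLp (A.indicator fun _ => (1 : ℝ)) 2 ρ := (memLp_const _).indicator hA
  have hbind := (disintegrates_condExpKernel (ρ := ρ) hM).bind_eq hM
  have hmeas n : AEStronglyMeasurable (ρ⟦A|m n⟧ - ρ⟦A|⨅ n, m n⟧) ρ :=
    integrable_condExp.aestronglyMeasurable.sub integrable_condExp.aestronglyMeasurable
  refine tendsto_of_tendsto_of_tendsto_of_le_of_le tendsto_const_nhds
    (tendsto_eLpNorm_two_condExp_iInf hm hle hL2) (fun n => zero_le) fun n => ?_
  calc ∫⁻ ω, ∫⁻ η, ‖(ρ⟦A|m n⟧ - ρ⟦A|⨅ n, m n⟧) η‖ₑ ∂condExpKernel ρ (⨅ n, m n) ω ∂ρ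
    _ = eLpNorm (ρ⟦A|m n⟧ - ρ⟦A|⨅ n, m n⟧) 1 ρ := by
      rw [eLpNorm_one_eq_lintegral_enorm, ← Measure.lintegral_bind
        ((condExpKernel ρ _).measurable.mono hM le_rfl).aemeasurable, hbind]
      exact hbind.symm ▸ (hmeas n).enorm
    _ ≤ eLpNorm (ρ⟦A|m n⟧ - ρ⟦A|⨅ n, m n⟧) 2 ρ :=
      eLpNorm_le_eLpNorm_of_exponent_le one_le_two (hmeas n)

theorem ae_isMixing_condExpKernel (hm : Antitone m) (hle : ∀ n, m n ≤ mΩ)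
    (hgen : ∀ n, @MeasurableSpace.CountablyGenerated Ω (m n)) :
    ∀ᵐ ω ∂ρ, IsMixing m (condExpKernel ρ (⨅ n, m n) ω) := by
  obtain ⟨𝒜, ℬ, h𝒜c, hℬc, h𝒜m, hℬm, hiff⟩ := exists_countable_isMixing_iff m hle hgen
  simp only [hiff]
  rw [ae_ball_iff h𝒜c]
  intro A hA
  have hcov : ∀ᵐ ω ∂ρ, ∀ n, ∀ B ∈ ℬ n, ‖eventCov (condExpKernel ρ (⨅ n, m n) ω) A B‖ₑ ≤
      ∫⁻ η, ‖(ρ⟦A|m n⟧ - ρ⟦A|⨅ n, m n⟧) η‖ₑ ∂condExpKernel ρ (⨅ n, m n) ω :=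
    ae_all_iff.2 fun n => (ae_ball_iff (hℬc n)).2 fun B hB =>
      ae_abs_eventCov_condExpKernel_le (iInf_le m n) (hle n) (h𝒜m A hA) (hℬm n B hB)
  have hsmall := ae_forall_exists_lt_of_tendsto_lintegral
    (fun n => measurable_lintegral_condExp_sub ((iInf_le m n).trans (hle n)) (hle n) A)
    (tendsto_lintegral_lintegral_condExp_sub (ρ := ρ) hm hle (h𝒜m A hA))
  filter_upwards [hcov, hsmall] with ω hω hω' k
  obtain ⟨n, hn⟩ := hω' (ENNReal.ofReal (1 / (k + 1))) (by positivity)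
  refine ⟨n, fun B hB => ?_⟩
  rw [← Real.norm_eq_abs, ← ENNReal.ofReal_le_ofReal_iff (by positivity), ofReal_norm]
  exact (hω n B hB).trans hn.le

theorem Disintegrates.ae_isMixing {κ : Kernel[⨅ n, m n, mΩ] Ω Ω} [IsFiniteKernel κ]
    (h : Disintegrates κ ρ) (hm : Antitone m) (hle : ∀ n, m n ≤ mΩ)
    (hgen : ∀ n, @MeasurableSpace.CountablyGenerated Ω (m n)) : ∀ᵐ ω ∂ρ, IsMixing m (κ ω) := by
  have hM : ⨅ n, m n ≤ mΩ := (iInf_le m 0).trans (hle 0)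
  filter_upwards [ae_isMixing_condExpKernel hm hle hgen,
    h.ae_eq (disintegrates_condExpKernel hM) hM] with ω hmix heq
  rwa [heq]

theorem isMixing_iff_isTrivialOn_iInf (hm : Antitone m) (hle : ∀ n, m n ≤ mΩ)
    (hgen : ∀ n, @MeasurableSpace.CountablyGenerated Ω (m n)) :
    IsMixing m ρ ↔ IsTrivialOn (⨅ n, m n) ρ := by
  refine ⟨fun h => h.isTrivialOn_iInf hle, fun h => ?_⟩
  have hM : ⨅ n, m n ≤ mΩ := (iInf_le m 0).trans (hle 0)
  simpa using (h.disintegrates_const hM).ae_isMixing hm hle hgen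

end ErgodicDecomposition

/-! ### Regular histories -/

section Tail

variable {X : Type*} [MeasurableSpace X]

variable (X) in
/-- The σ-algebra `Σₙ` of the events that depend only on the coordinates from `n` on. -/
@[reducible] def shiftAlgebra (n : ℕ) : MeasurableSpace (ℕ → X) :=
  MeasurableSpace.comap (fun ξ k => ξ (n + k)) MeasurableSpace.pi

theorem shiftAlgebra_le (n : ℕ) : shiftAlgebra X n ≤ MeasurableSpace.pi :=
  Measurable.comap_le (measurable_pi_lambda _ fun k => measurable_pi_apply (n + k))

theorem antitone_shiftAlgebra : Antitone (shiftAlgebra X) := by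
  refine antitone_nat_of_succ_le fun n => ?_
  have hcomp : (fun (ξ : ℕ → X) k => ξ (n + 1 + k)) =
      (fun ξ k => ξ (1 + k)) ∘ fun ξ k => ξ (n + k) := by
    ext ξ k
    simp [add_assoc]
  rw [shiftAlgebra, hcomp, ← MeasurableSpace.comap_comp]
  exact MeasurableSpace.comap_mono (shiftAlgebra_le 1)

theorem countablyGenerated_shiftAlgebra [MeasurableSpace.CountablyGenerated (ℕ → X)] (n : ℕ) :
    @MeasurableSpace.CountablyGenerated (ℕ → X) (shiftAlgebra X n) :=
  .comap _

theorem tailAlgebra_le : tailAlgebra X ≤ MeasurableSpace.pi :=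
  (iInf_le _ 0).trans (shiftAlgebra_le 0)

theorem IsErgodicDisintegration.exists_kernel {μ : Measure (ℕ → X)}
    {κ : (ℕ → X) → Measure (ℕ → X)} (h : IsErgodicDisintegration μ κ) :
    ∃ κ' : Kernel[tailAlgebra X, MeasurableSpace.pi] (ℕ → X) (ℕ → X),
      IsMarkovKernel κ' ∧ ⇑κ' = κ :=
  ⟨@Kernel.mk _ _ (tailAlgebra X) _ κ
    (@Measure.measurable_of_measurable_coe _ _ _ (tailAlgebra X) _ h.measurable),
    @IsMarkovKernel.mk _ _ (tailAlgebra X) _ _ h.isProbabilityMeasure, rfl⟩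

variable {κ : Kernel[tailAlgebra X, MeasurableSpace.pi] (ℕ → X) (ℕ → X)} [IsMarkovKernel κ]
  {ξ : ℕ → X} {ρ : Measure (ℕ → X)}

theorem isDisintegratedBy_iff_isTrivialOn (h : ∀ᵐ η ∂κ ξ, κ ξ = κ η) :
    IsDisintegratedBy (κ ξ) κ ↔ IsTrivialOn (tailAlgebra X) (κ ξ) := by
  have hconst (Δ Λ : Set (ℕ → X)) : ∫⁻ η in Λ, κ η Δ ∂κ ξ = ∫⁻ _ in Λ, κ ξ Δ ∂κ ξ :=
    lintegral_congr_ae (ae_restrict_of_ae (h.mono fun η hη => by simp only [hη]))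
  refine ⟨fun hd Λ hΛ => ?_, fun ht Δ Λ hΔ hΛ => ?_⟩
  · have hsq : κ ξ Λ * κ ξ Λ = κ ξ Λ := by
      simpa [hconst] using hd Λ Λ (tailAlgebra_le _ hΛ) hΛ
    exact (eq_or_ne (κ ξ Λ) 0).imp_right fun h0 =>
      (ENNReal.mul_eq_right h0 (measure_ne_top _ _)).1 hsq
  · exact (hconst Δ Λ).trans (ht.disintegrates_const tailAlgebra_le Δ Λ hΔ hΛ)

section CountablyGenerated

variable [MeasurableSpace.CountablyGenerated (ℕ → X)]

theorem measurableSet_molecule (ξ : ℕ → X) : MeasurableSet[tailAlgebra X] (molecule κ ξ) :=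
  measurableSet_setOf_eq (mα := tailAlgebra X) (@Kernel.const _ _ (tailAlgebra X) _ (κ ξ)) κ

theorem measure_molecule_eq_one_iff : κ ξ (molecule κ ξ) = 1 ↔ ∀ᵐ η ∂κ ξ, κ ξ = κ η :=
  (mem_ae_iff_prob_eq_one (tailAlgebra_le _ (measurableSet_molecule ξ))).symm

theorem mem_regularSet_iff :
    ξ ∈ regularSet κ ↔ IsTrivialOn (tailAlgebra X) (κ ξ) ∧ κ ξ (molecule κ ξ) = 1 :=
  and_congr_left fun h => isDisintegratedBy_iff_isTrivialOn (measure_molecule_eq_one_iff.1 h)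

theorem ae_eq_of_mem_regularSet (hξ : ξ ∈ regularSet κ) : ∀ᵐ η ∂κ ξ, κ ξ = κ η :=
  measure_molecule_eq_one_iff.1 hξ.2

theorem measurableSet_setOf_measure_molecule :
    MeasurableSet[tailAlgebra X] {ξ | κ ξ (molecule κ ξ) = 1} :=
  Kernel.measurable_kernel_prodMk_left (measurableSet_setOf_apply_eq_apply tailAlgebra_le κ)
    (measurableSet_singleton 1)

end CountablyGenerated

variable [StandardBorelSpace X]

theorem measurableSet_regularSet : MeasurableSet[tailAlgebra X] (regularSet κ) := by
  have hregular : regularSet κ =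
      {ξ | IsMixing (shiftAlgebra X) (κ ξ)} ∩ {ξ | κ ξ (molecule κ ξ) = 1} := by
    ext ξ
    rw [mem_regularSet_iff, ← isMixing_iff_isTrivialOn_iInf antitone_shiftAlgebra shiftAlgebra_le
      countablyGenerated_shiftAlgebra]
    rfl
  rw [hregular]
  exact (measurableSet_setOf_isMixing shiftAlgebra_le countablyGenerated_shiftAlgebra κ).inter
    measurableSet_setOf_measure_molecule

theorem IsDisintegratedBy.ae_mem_regularSet [IsProbabilityMeasure ρ]
    (h : IsDisintegratedBy ρ κ) : ∀ᵐ ξ ∂ρ, ξ ∈ regularSet κ := by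
  have hd : Disintegrates κ ρ := h
  filter_upwards [hd.ae_isMixing antitone_shiftAlgebra shiftAlgebra_le
    countablyGenerated_shiftAlgebra, hd.ae_ae_eq tailAlgebra_le] with ξ hmix hmol
  exact mem_regularSet_iff.2
    ⟨hmix.isTrivialOn_iInf shiftAlgebra_le, measure_molecule_eq_one_iff.2 hmol⟩

theorem exists_isErgodicDisintegration (μ : Measure (ℕ → X)) [IsProbabilityMeasure μ] :
    ∃ κ : (ℕ → X) → Measure (ℕ → X), IsErgodicDisintegration μ κ :=
  ⟨condExpKernel μ (tailAlgebra X), fun _ => inferInstance,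
    fun _ hΔ => measurable_condExpKernel hΔ, disintegrates_condExpKernel tailAlgebra_le, by
      filter_upwards [ae_isMixing_condExpKernel antitone_shiftAlgebra shiftAlgebra_le
        countablyGenerated_shiftAlgebra] with ξ hξ
      exact hξ.isTrivialOn_iInf shiftAlgebra_le⟩

end Tail

/-! ### The space of molecules -/

section MoleculeSpace

variable {X : Type*} [MeasurableSpace X]

/-- The quotient map `p` onto the set of molecules. -/
def toMolecule (κ : (ℕ → X) → Measure (ℕ → X)) (ξ : regularSet κ) : MoleculeSpace κ :=
  Quotient.mk (moleculeSetoid κ) ξ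

/-- The image of `ρ` under the quotient map `p`; mass outside `regularSet κ` is dropped. -/
noncomputable def moleculeLaw (κ : (ℕ → X) → Measure (ℕ → X)) (ρ : Measure (ℕ → X)) :
    Measure (MoleculeSpace κ) :=
  (ρ.comap Subtype.val).map (toMolecule κ)

section Preimage

variable {κ : (ℕ → X) → Measure (ℕ → X)}

theorem surjective_toMolecule : Function.Surjective (toMolecule κ) :=
  Quotient.mk_surjective

theorem preimageMol_eq (E : Set (MoleculeSpace κ)) :
    preimageMol κ E = Subtype.val '' (toMolecule κ ⁻¹' E) :=
  rfl

theorem mem_preimageMol {E : Set (MoleculeSpace κ)} {ξ : ℕ → X} :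
    ξ ∈ preimageMol κ E ↔ ∃ h : ξ ∈ regularSet κ, toMolecule κ ⟨ξ, h⟩ ∈ E := by
  simp [preimageMol_eq]

theorem preimageMol_univ : preimageMol κ Set.univ = regularSet κ := by
  simp [preimageMol_eq]

theorem preimageMol_compl (E : Set (MoleculeSpace κ)) :
    preimageMol κ Eᶜ = regularSet κ \ preimageMol κ E := by
  ext ξ
  simp only [mem_preimageMol, Set.mem_sdiff, Set.mem_compl_iff, not_exists]
  exact ⟨fun ⟨h, h'⟩ => ⟨h, fun _ => h'⟩, fun ⟨h, h'⟩ => ⟨h, h' h⟩⟩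

theorem preimageMol_iUnion {ι : Type*} (E : ι → Set (MoleculeSpace κ)) :
    preimageMol κ (⋃ i, E i) = ⋃ i, preimageMol κ (E i) := by
  simp only [preimageMol_eq, Set.preimage_iUnion, Set.image_iUnion]

theorem mem_regularSet_congr {ξ η : ℕ → X} (h : κ ξ = κ η) :
    ξ ∈ regularSet κ ↔ η ∈ regularSet κ := by
  simp [regularSet, molecule, h]

theorem mem_preimageMol_congr {E : Set (MoleculeSpace κ)} {ξ η : ℕ → X} (h : κ ξ = κ η) :
    ξ ∈ preimageMol κ E ↔ η ∈ preimageMol κ E := by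
  have hmol (hξ) (hη) : toMolecule κ ⟨ξ, hξ⟩ = toMolecule κ ⟨η, hη⟩ := Quotient.sound h
  simp only [mem_preimageMol]
  exact ⟨fun ⟨hξ, hE⟩ => ⟨(mem_regularSet_congr h).1 hξ, hmol hξ _ ▸ hE⟩,
    fun ⟨hη, hE⟩ => ⟨(mem_regularSet_congr h).2 hη, hmol _ hη ▸ hE⟩⟩

theorem isDisintegratedBy_molMeasure (ν : MoleculeSpace κ) :
    IsDisintegratedBy (molMeasure κ ν) κ := by
  obtain ⟨ξ, rfl⟩ := surjective_toMolecule ν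
  exact ξ.2.1

theorem IsImage.eq {ρ : Measure (ℕ → X)} {P Q : Measure (MoleculeSpace κ)} (hP : IsImage ρ κ P)
    (hQ : IsImage ρ κ Q) : P = Q :=
  Measure.ext fun E hE => by rw [hP E hE, hQ E hE]

end Preimage

variable {κ : Kernel[tailAlgebra X, MeasurableSpace.pi] (ℕ → X) (ℕ → X)} [IsMarkovKernel κ]
  {ρ : Measure (ℕ → X)} [StandardBorelSpace X]

theorem measurableSet_moleculeSpace_iff {E : Set (MoleculeSpace κ)} :
    MeasurableSet E ↔ MeasurableSet[tailAlgebra X] (preimageMol κ E) := by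
  refine ⟨fun h => ?_, fun h => MeasurableSpace.measurableSet_generateFrom h⟩
  induction E, h using MeasurableSpace.generateFrom_induction with
  | hC _ hE _ => exact hE
  | empty => simp [preimageMol_eq]
  | compl E _ ih => exact preimageMol_compl E ▸ measurableSet_regularSet.diff ih
  | iUnion E _ ih => exact preimageMol_iUnion E ▸ .iUnion ih

theorem measurableSet_preimageMol {E : Set (MoleculeSpace κ)} (hE : MeasurableSet E) :
    MeasurableSet (preimageMol κ E) :=
  tailAlgebra_le _ (measurableSet_moleculeSpace_iff.1 hE)

theorem measurable_toMolecule : Measurable (toMolecule κ) := fun E hE => by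
  rw [← Set.preimage_image_eq (toMolecule κ ⁻¹' E) Subtype.val_injective, ← preimageMol_eq]
  exact measurable_subtype_coe (measurableSet_preimageMol hE)

theorem measurable_molMeasure_apply {Δ : Set (ℕ → X)} (hΔ : MeasurableSet Δ) :
    Measurable fun ν => molMeasure κ ν Δ := fun T hT => by
  have hpre : preimageMol κ ((fun ν => molMeasure κ ν Δ) ⁻¹' T) =
      regularSet κ ∩ (fun ξ => κ ξ Δ) ⁻¹' T := by
    ext ξ
    simp only [mem_preimageMol, Set.mem_inter_iff, Set.mem_preimage]
    exact ⟨fun ⟨h, h'⟩ => ⟨h, h'⟩, fun ⟨h, h'⟩ => ⟨h, h'⟩⟩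
  rw [measurableSet_moleculeSpace_iff, hpre]
  exact measurableSet_regularSet.inter (κ.measurable_coe hΔ hT)

theorem measurable_molMeasure : Measurable (molMeasure κ) :=
  Measure.measurable_of_measurable_coe _ fun _ => measurable_molMeasure_apply

theorem isImage_moleculeLaw : IsImage ρ κ (moleculeLaw κ ρ) := fun E hE => by
  rw [moleculeLaw, Measure.map_apply measurable_toMolecule hE,
    comap_subtype_coe_apply (tailAlgebra_le _ measurableSet_regularSet), preimageMol_eq]

theorem setLIntegral_moleculeLaw {Δ : Set (ℕ → X)} {E : Set (MoleculeSpace κ)}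
    (hΔ : MeasurableSet Δ) (hE : MeasurableSet E) :
    ∫⁻ ν in E, molMeasure κ ν Δ ∂moleculeLaw κ ρ = ∫⁻ ξ in preimageMol κ E, κ ξ Δ ∂ρ := by
  rw [moleculeLaw, setLIntegral_map hE (measurable_molMeasure_apply hΔ) measurable_toMolecule,
    preimageMol_eq, ← setLIntegral_subtype (tailAlgebra_le _ measurableSet_regularSet)]
  rfl

theorem molMeasure_preimageMol {E : Set (MoleculeSpace κ)} (hE : MeasurableSet E)
    (ν : MoleculeSpace κ) : molMeasure κ ν (preimageMol κ E) = E.indicator 1 ν := by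
  obtain ⟨ξ, rfl⟩ := surjective_toMolecule ν
  have hmem : ∀ᵐ η ∂κ ξ, η ∈ preimageMol κ E ↔ toMolecule κ ξ ∈ E := by
    filter_upwards [ae_eq_of_mem_regularSet ξ.2] with η hη
    rw [← mem_preimageMol_congr hη, mem_preimageMol]
    exact ⟨fun ⟨_, h⟩ => h, fun h => ⟨ξ.2, h⟩⟩
  change κ ξ (preimageMol κ E) = _
  by_cases h : toMolecule κ ξ ∈ E
  · rw [Set.indicator_of_mem h, Pi.one_apply,
      ← mem_ae_iff_prob_eq_one (measurableSet_preimageMol hE)]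
    exact hmem.mono fun η hη => hη.2 h
  · rw [Set.indicator_of_notMem h, measure_eq_zero_iff_ae_notMem]
    exact hmem.mono fun η hη => mt hη.1 h

theorem IsMixture.isImage {Q : Measure (MoleculeSpace κ)} (hQ : IsMixture ρ κ Q) :
    IsImage ρ κ Q := fun E hE => by
  simp only [hQ _ (measurableSet_preimageMol hE), molMeasure_preimageMol hE,
    lintegral_indicator_one hE]

theorem IsMixture.isDisintegratedBy {P : Measure (MoleculeSpace κ)} (hP : IsMixture ρ κ P) :
    IsDisintegratedBy ρ κ := fun Δ Λ hΔ hΛ => by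
  have hΛ' := tailAlgebra_le _ hΛ
  have hbind : ρ = P.bind (molMeasure κ) := Measure.ext fun Δ hΔ => by
    rw [hP Δ hΔ, Measure.bind_apply hΔ measurable_molMeasure.aemeasurable]
  have hκΔ : Measurable fun η => κ η Δ := (κ.measurable_coe hΔ).mono tailAlgebra_le le_rfl
  calc ∫⁻ η in Λ, κ η Δ ∂ρ
      = ∫⁻ η, Λ.indicator (fun η => κ η Δ) η ∂P.bind (molMeasure κ) := by
        rw [lintegral_indicator hΛ', ← hbind]
    _ = ∫⁻ ν, ∫⁻ η in Λ, κ η Δ ∂molMeasure κ ν ∂P := by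
        rw [Measure.lintegral_bind measurable_molMeasure.aemeasurable
          (hκΔ.indicator hΛ').aemeasurable]
        simp only [lintegral_indicator hΛ']
    _ = ∫⁻ ν, molMeasure κ ν (Λ ∩ Δ) ∂P :=
        lintegral_congr fun ν => isDisintegratedBy_molMeasure ν Δ Λ hΔ hΛ
    _ = ρ (Λ ∩ Δ) := (hP _ (hΛ'.inter hΔ)).symm

variable [IsProbabilityMeasure ρ]

theorem IsDisintegratedBy.measure_regularSet (h : IsDisintegratedBy ρ κ) :
    ρ (regularSet κ) = 1 :=
  (mem_ae_iff_prob_eq_one (tailAlgebra_le _ measurableSet_regularSet)).1 h.ae_mem_regularSet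

theorem IsDisintegratedBy.isMolDisintegrated (h : IsDisintegratedBy ρ κ) :
    IsMolDisintegrated ρ κ := by
  refine ⟨moleculeLaw κ ρ, ⟨?_⟩, isImage_moleculeLaw, fun Δ E hΔ hE => ?_⟩
  · rw [isImage_moleculeLaw _ .univ, preimageMol_univ, h.measure_regularSet]
  · rw [setLIntegral_moleculeLaw hΔ hE, h Δ _ hΔ (measurableSet_moleculeSpace_iff.1 hE)]

theorem IsMolDisintegrated.exists_isMixture (h : IsMolDisintegrated ρ κ) :
    ∃ P : Measure (MoleculeSpace κ), IsProbabilityMeasure P ∧ IsImage ρ κ P ∧ IsMixture ρ κ P := by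
  obtain ⟨P, hP, himage, hd⟩ := h
  have hreg : ρ (regularSet κ)ᶜ = 0 := by
    rw [prob_compl_eq_zero_iff (tailAlgebra_le _ measurableSet_regularSet), ← preimageMol_univ,
      ← himage _ .univ, measure_univ]
  refine ⟨P, hP, himage, fun Δ hΔ => ?_⟩
  rw [← setLIntegral_univ, hd Δ _ hΔ .univ, preimageMol_univ, Set.inter_comm,
    measure_inter_conull hreg]

theorem isDisintegratedBy_iff_isMolDisintegrated :
    IsDisintegratedBy ρ κ ↔ IsMolDisintegrated ρ κ :=
  ⟨fun h => h.isMolDisintegrated, fun h =>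
    let ⟨_, _, _, hP⟩ := h.exists_isMixture
    hP.isDisintegratedBy⟩

theorem IsDisintegratedBy.exists_unique_isMixture (h : IsDisintegratedBy ρ κ) :
    ∃ P : Measure (MoleculeSpace κ), IsProbabilityMeasure P ∧ IsImage ρ κ P ∧ IsMixture ρ κ P ∧
      ∀ Q : Measure (MoleculeSpace κ), IsProbabilityMeasure Q → IsMixture ρ κ Q → Q = P := by
  obtain ⟨P, hP, himage, hmix⟩ := h.isMolDisintegrated.exists_isMixture
  exact ⟨P, hP, himage, hmix, fun Q _ hQ =>
    hQ.isImage.eq himage⟩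

end MoleculeSpace

/-! ### Convexity and extreme points -/

section Convexity

variable {X : Type*} [MeasurableSpace X] {ρ : Measure (ℕ → X)}

theorem IsDisintegratedBy.cond {κ : (ℕ → X) → Measure (ℕ → X)} (h : IsDisintegratedBy ρ κ)
    {Λ : Set (ℕ → X)} (hΛ : MeasurableSet[tailAlgebra X] Λ) : IsDisintegratedBy ρ[|Λ] κ := by
  intro Δ Λ' hΔ hΛ'
  rw [ProbabilityTheory.cond, Measure.restrict_smul, lintegral_smul_measure, Measure.smul_apply,
    Measure.restrict_restrict (tailAlgebra_le _ hΛ'), h Δ _ hΔ (hΛ'.inter hΛ),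
    Measure.restrict_apply ((tailAlgebra_le _ hΛ').inter hΔ), Set.inter_right_comm]

theorem smul_cond_add_smul_cond_compl {Ω : Type*} {mΩ : MeasurableSpace Ω} (ρ : Measure Ω)
    [IsFiniteMeasure ρ] {Λ : Set Ω} (hΛ : MeasurableSet Λ) :
    (ρ Λ).toNNReal • ρ[|Λ] + (ρ Λᶜ).toNNReal • ρ[|Λᶜ] = ρ := by
  ext Δ -
  simp only [Measure.add_apply, Measure.smul_apply, ENNReal.smul_def, smul_eq_mul,
    ENNReal.coe_toNNReal (measure_ne_top _ _)]
  rw [mul_comm, cond_mul_eq_inter hΛ, mul_comm, cond_mul_eq_inter hΛ.compl, Set.inter_comm,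
    Set.inter_comm Λᶜ, ← Set.sdiff_eq, measure_inter_add_sdiff Δ hΛ]

variable [TopologicalSpace X] [PolishSpace X] [BorelSpace X]

theorem mem_disintegratedSet_iff {κ : (ℕ → X) → Measure (ℕ → X)} :
    ρ ∈ disintegratedSet κ ↔ IsProbabilityMeasure ρ ∧ IsDisintegratedBy ρ κ :=
  ⟨fun ⟨hρ, _, h⟩ => ⟨hρ, h⟩, fun ⟨hρ, h⟩ => ⟨hρ, inferInstance, h⟩⟩

theorem convex_disintegratedSet (κ : (ℕ → X) → Measure (ℕ → X)) :
    Convex ℝ≥0 (disintegratedSet κ) := by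
  intro ρ₁ h₁ ρ₂ h₂ a b _ _ hab
  rw [mem_disintegratedSet_iff] at h₁ h₂ ⊢
  obtain ⟨hρ₁, hd₁⟩ := h₁
  obtain ⟨hρ₂, hd₂⟩ := h₂
  refine ⟨⟨?_⟩, fun Δ Λ hΔ hΛ => ?_⟩
  · simp only [Measure.add_apply, Measure.smul_apply, measure_univ, ENNReal.smul_def, smul_eq_mul,
      mul_one]
    exact_mod_cast hab
  · simp only [Measure.restrict_add, Measure.restrict_smul, lintegral_add_measure,
      lintegral_smul_measure, Measure.add_apply, Measure.smul_apply, hd₁ Δ Λ hΔ hΛ, hd₂ Δ Λ hΔ hΛ]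

theorem isTrivialOn_of_mem_extremePoints {κ : (ℕ → X) → Measure (ℕ → X)}
    (h : ρ ∈ Set.extremePoints ℝ≥0 (disintegratedSet κ)) : IsTrivialOn (tailAlgebra X) ρ := by
  obtain ⟨hmem, hext⟩ := h
  obtain ⟨hρ, hd⟩ := mem_disintegratedSet_iff.1 hmem
  intro Λ hΛ
  by_contra! hne
  have hΛ' := tailAlgebra_le _ hΛ
  have hc : ρ Λᶜ ≠ 0 := fun h0 => hne.2 ((prob_compl_eq_zero_iff hΛ').1 h0)
  have hcond : ρ[|Λ] = ρ := by
    refine hext (mem_disintegratedSet_iff.2 ⟨cond_isProbabilityMeasure hne.1, hd.cond hΛ⟩)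
      (mem_disintegratedSet_iff.2 ⟨cond_isProbabilityMeasure hc, hd.cond hΛ.compl⟩)
      ⟨(ρ Λ).toNNReal, (ρ Λᶜ).toNNReal, ENNReal.toNNReal_pos hne.1 (measure_ne_top _ _),
        ENNReal.toNNReal_pos hc (measure_ne_top _ _), ?_, smul_cond_add_smul_cond_compl ρ hΛ'⟩
    rw [← ENNReal.toNNReal_add (measure_ne_top _ _) (measure_ne_top _ _), prob_add_prob_compl hΛ',
      ENNReal.toNNReal_one]
  exact hne.2 (hcond ▸ cond_apply_self hne.1 (measure_ne_top _ _))

variable {κ : Kernel[tailAlgebra X, MeasurableSpace.pi] (ℕ → X) (ℕ → X)} [IsMarkovKernel κ]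

theorem IsTrivialOn.mem_range_molMeasure [IsProbabilityMeasure ρ]
    (h : IsTrivialOn (tailAlgebra X) ρ) (hd : IsDisintegratedBy ρ κ) :
    ρ ∈ Set.range (molMeasure κ) := by
  have hd' : Disintegrates κ ρ := hd
  have hconst := hd'.ae_eq (h.disintegrates_const tailAlgebra_le) tailAlgebra_le
  obtain ⟨ξ, hξ, hreg⟩ := (hconst.and hd.ae_mem_regularSet).exists
  exact ⟨toMolecule κ ⟨ξ, hreg⟩, hξ⟩

theorem IsDisintegratedBy.eq_of_absolutelyContinuous [IsProbabilityMeasure ρ] {ξ : ℕ → X}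
    (h : IsDisintegratedBy ρ κ) (hξ : ξ ∈ regularSet κ) (hρ : ρ ≪ κ ξ) : ρ = κ ξ := by
  ext Δ hΔ
  have hae : ∀ᵐ η ∂ρ, κ η Δ = κ ξ Δ :=
    hρ.ae_le ((ae_eq_of_mem_regularSet hξ).mono fun η hη => by rw [hη])
  calc ρ Δ = ∫⁻ η, κ η Δ ∂ρ := by simpa using (h Δ Set.univ hΔ .univ).symm
    _ = κ ξ Δ := by simp [lintegral_congr_ae hae]

theorem molMeasure_mem_extremePoints (ν : MoleculeSpace κ) :
    molMeasure κ ν ∈ Set.extremePoints ℝ≥0 (disintegratedSet κ) := by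
  obtain ⟨⟨ξ, hξ⟩, rfl⟩ := surjective_toMolecule ν
  change κ ξ ∈ _
  refine ⟨mem_disintegratedSet_iff.2 ⟨inferInstance, hξ.1⟩, ?_⟩
  rintro ρ₁ h₁ ρ₂ - ⟨a, b, ha, -, -, hab⟩
  obtain ⟨hρ₁, hd₁⟩ := mem_disintegratedSet_iff.1 h₁
  refine hd₁.eq_of_absolutelyContinuous hξ fun s hs => ?_
  rw [← hab, Measure.add_apply, add_eq_zero, Measure.smul_apply, smul_eq_zero] at hs
  exact hs.1.resolve_left ha.ne'

theorem extremePoints_disintegratedSet :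
    Set.extremePoints ℝ≥0 (disintegratedSet κ) = Set.range (molMeasure κ) := by
  refine Set.Subset.antisymm (fun ρ h => ?_) (Set.range_subset_iff.2 molMeasure_mem_extremePoints)
  obtain ⟨_, hd⟩ := mem_disintegratedSet_iff.1 h.1
  exact (isTrivialOn_of_mem_extremePoints h).mem_range_molMeasure hd

end Convexity

end Histories

theorem corollary1p7_general {X : Type*} [TopologicalSpace X] [PolishSpace X]
    [MeasurableSpace X] [BorelSpace X] (μ : Measure (ℕ → X)) [IsProbabilityMeasure μ] :
    (∃ κ : (ℕ → X) → Measure (ℕ → X), IsErgodicDisintegration μ κ) ∧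
    ∀ κ : (ℕ → X) → Measure (ℕ → X), IsErgodicDisintegration μ κ →
      Convex ℝ≥0 (disintegratedSet κ) ∧
      Set.extremePoints ℝ≥0 (disintegratedSet κ) = Set.range (molMeasure κ) ∧
      MeasurableSet (regularSet κ) ∧
      (∀ ρ ∈ disintegratedSet κ, ρ (regularSet κ) = 1) ∧
      (∀ ρ : Measure (ℕ → X), ρ ∈ disintegratedSet κ ↔
        IsProbabilityMeasure ρ ∧ ρ.Regular ∧ IsMolDisintegrated ρ κ) ∧
      μ ∈ disintegratedSet κ ∧
      (∀ Δ : Set (ℕ → X), MeasurableSet Δ → Measurable fun ν => molMeasure κ ν Δ) ∧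
      ∀ ρ ∈ disintegratedSet κ, ∃ P : Measure (MoleculeSpace κ),
        IsProbabilityMeasure P ∧ IsImage ρ κ P ∧ IsMixture ρ κ P ∧
        ∀ Q : Measure (MoleculeSpace κ), IsProbabilityMeasure Q → IsMixture ρ κ Q → Q = P := by
  refine ⟨exists_isErgodicDisintegration μ, fun κ hκ => ?_⟩
  have hμ : μ ∈ disintegratedSet κ := mem_disintegratedSet_iff.2 ⟨‹_›, hκ.isDisintegratedBy⟩
  obtain ⟨κ, _, rfl⟩ := hκ.exists_kernel
  exact ⟨convex_disintegratedSet κ, extremePoints_disintegratedSet,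
    tailAlgebra_le _ measurableSet_regularSet, fun ρ ⟨_, _, hρ⟩ => hρ.measure_regularSet,
    fun ρ => and_congr_right fun _ => and_congr_right fun _ =>
      isDisintegratedBy_iff_isMolDisintegrated,
    hμ, fun Δ => measurable_molMeasure_apply, fun ρ ⟨_, _, hρ⟩ => hρ.exists_unique_isMixture⟩

theorem corollary1p7
    {H : Type*} [NormedAddCommGroup H] [InnerProductSpace ℂ H] [CompleteSpace H]
    [TopologicalSpace.SeparableSpace H]
    {X : Type*} [Fintype X] [TopologicalSpace X] [DiscreteTopology X]
    [MeasurableSpace X] [DiscreteMeasurableSpace X]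
    (S : QuantumSystem H X) (hdec : S.IdealDecoherence) (habel : S.AsymptoticAbelianness)
    (ω : (H →L[ℂ] H) → ℂ) (hω : IsNormalState S.vN ω) :
    (∃! μ : Measure (ℕ → X), S.IsHistoryMeasure ω μ) ∧
    ∀ μ : Measure (ℕ → X), S.IsHistoryMeasure ω μ →
      (∃ κ : (ℕ → X) → Measure (ℕ → X), IsErgodicDisintegration μ κ) ∧
      ∀ κ : (ℕ → X) → Measure (ℕ → X), IsErgodicDisintegration μ κ →
        -- `𝓚` is convex, and its extreme points are exactly the measures `μ(· | ν)`
        Convex ℝ≥0 (disintegratedSet κ) ∧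
        Set.extremePoints ℝ≥0 (disintegratedSet κ) = Set.range (molMeasure κ) ∧
        -- every element of `𝓚` is carried by the union of the molecules that make up `Ξ^∞`,
        -- and `𝓚` can be described by disintegration over `Ξ^∞`
        MeasurableSet (regularSet κ) ∧
        (∀ ρ ∈ disintegratedSet κ, ρ (regularSet κ) = 1) ∧
        (∀ ρ : Measure (ℕ → X), ρ ∈ disintegratedSet κ ↔
          IsProbabilityMeasure ρ ∧ ρ.Regular ∧ IsMolDisintegrated ρ κ) ∧
        -- Choquet-type decomposition of the elements of `𝓚`, in particular of `μ_ω`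
        μ ∈ disintegratedSet κ ∧
        (∀ Δ : Set (ℕ → X), MeasurableSet Δ → Measurable fun ν => molMeasure κ ν Δ) ∧
        ∀ ρ ∈ disintegratedSet κ, ∃ P : Measure (MoleculeSpace κ),
          IsProbabilityMeasure P ∧ IsImage ρ κ P ∧ IsMixture ρ κ P ∧
          ∀ Q : Measure (MoleculeSpace κ), IsProbabilityMeasure Q → IsMixture ρ κ Q → Q = P :=
  ⟨S.existsUnique_isHistoryMeasure hω hdec, fun μ hμ =>
    have := hμ.isProbabilityMeasure
    corollary1p7_general μ⟩
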